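/- Let $g_s:\mathbb{R}^n\times\mathbb{R}^m\times\mathbb{R}^p\to\mathbb{R}^n$ and $g_f:\mathbb{R}^m\times\mathbb{R}^n\times\mathbb{R}^q\to\mathbb{R}^m$, and for functions $\rho_s:\mathbb{R}^n\times\mathbb{R}^m\times\mathbb{R}^p\to\mathbb{R}_+$, $\rho_f:\mathbb{R}^m\times\mathbb{R}^n\times\mathbb{R}^q\to\mathbb{R}_+$ consider the system $$\dot x=\rho_s(x,z,d)\,g_s(x,z,d),\qquad \dot z=\rho_f(z,x,w)\,g_f(z,x,w) \qquad (1)$$ with state $(x,z)\in\mathbb{R}^n\times\mathbb{R}^m$ and input $(d,w)\in\mathbb{R}^p\times\mathbb{R}^q$. Suppose that $g_f$ is locally Lipschitz in $(z,x)$, uniformly for $w$ in bounded sets, and Borel measurable in $w$ and locally bounded (for example piecewise continuous in $w$). $|\cdot|$ is the Euclidean norm. A continuous $\alpha:\mathbb{R}_+\to\mathbb{R}_+$ is of class $\mathcal{PD}$ if $\alpha(0)=0$ and $\alpha(r)>0$ for $r>0$; of class $\mathcal{K}$ if it is strictly increasing and $\alpha(0)=0$; of class $\mathcal{K}_\infty$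 if it is moreover unbounded. A continuous $\beta:\mathbb{R}_+\times\mathbb{R}_+\to\mathbb{R}_+$ is of class $\mathcal{KL}$ if $\beta(\cdot,t)\in\mathcal{K}$ for every $t$, and for every $s>0$ the function $\beta(s,\cdot)$ is decreasing and tends to $0$ at infinity. Assumption 1. There is a locally Lipschitz $\varphi:\mathbb{R}^n\to\mathbb{R}^m$ with $g_s(0,\varphi(0),0)=0$ and $g_f(\varphi(x),x,0)=0$ for all $x$. Assumption 2. There are continuously differentiable $V_s:\mathbb{R}^n\to\mathbb{R}_+$, $V_f:\mathbb{R}^m\times\mathbb{R}^n\to\mathbb{R}_+$, functions $\underline\alpha_s,\overline\alpha_s,\gamma_s,\chi_s,\underline\alpha_f,\overline\alpha_f,\chi_f\in\mathcal{K}_\infty$ and $\alpha_s,\alpha_f,\lambda_{f1},\lambda_{f2}\in\mathcal{PD}$ such that for all $x,z,d,w$: $$\underline\alpha_s(|x|)\le V_s(x)\le\overline\alpha_s(|x|),\qquad \underline\alpha_f(|z-\varphi(x)|)\le V_f(z,x)\le\overline\alpha_f(|z-\varphi(x)|),$$ $$V_s(x)\ge\max\{\gamma_s(V_f(z,x)),\chi_s(|d|)\}\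 \Rightarrow\ \tfrac{\partial V_s(x)}{\partial x}g_s(x,z,d)\le-\alpha_s(V_s(x)),$$ $$V_f(z,x)\ge\chi_f(|w|)\ \Rightarrow\ \tfrac{\partial V_f(z,x)}{\partial z}g_f(z,x,w)\le-\alpha_f(V_f(z,x)),$$ $$\left|\tfrac{\partial V_f(z,x)}{\partial x}\right|\le\lambda_{f1}(V_f(z,x))+\lambda_{f2}(V_s(x)).$$ Suppose that Assumptions 1 and 2 hold with such data for which, in addition, $g_s$, $\gamma_s$ and $\alpha_f^{-1}$ are globally Lipschitz ($\alpha_f$ being invertible on $\mathbb{R}_+$); $\underline\alpha_s$ and $\underline\alpha_f$ are square functions, i.e. of the form $r\mapsto ar^2$ with $a>0$; and $\lambda_{f1}$ and $\lambda_{f2}$ are square-root functions, i.e. of the form $r\mapsto a\sqrt r$ with $a>0$ (the constants may be different for each function). Then there exist constants $c_s,c_f>0$ such that the system (1) with $\rho_s\equiv c_s$ and $\rho_f\equiv c_f$ is input-to-state stable with $(x,z-\varphi(0))$ as the state and $(d,w)$ as the input. That is, there are $\beta\in\mathcal{KL}$ and $\chi\in\mathcal{K}$ such that for every measurable, locally essentially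 bounded input $(d,w)$ and every initial state a solution exists on $[0,\infty)$, and every solution satisfies, for all $t\ge0$ in its interval of existence, $$|(x(t),z(t)-\varphi(0))|\le\max\{\beta(|(x(0),z(0)-\varphi(0))|,t),\ \chi(\|(d,w)\|_\infty)\},$$ where $\|(d,w)\|_\infty$ is the essential supremum of $|(d,w)|$ over $[0,t]$. -/

import Mathlib

open Set Filter Topology MeasureTheory

noncomputable section

/-! ### Comparison functions

A function from `ℝ₊` to `ℝ₊` is represented by a function `ℝ → ℝ` of which only the values on
`[0, ∞)` matter. -/

/-- Class `𝒫𝒟`: continuous on `[0, ∞)`, positive on `(0, ∞)`, zero at zero. -/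
def IsPD (α : ℝ → ℝ) : Prop :=
  ContinuousOn α (Ici 0) ∧ (∀ r, 0 < r → 0 < α r) ∧ α 0 = 0

/-- Class `𝒦`: continuous and strictly increasing on `[0, ∞)`, zero at zero. -/
def IsK (α : ℝ → ℝ) : Prop :=
  ContinuousOn α (Ici 0) ∧ StrictMonoOn α (Ici 0) ∧ α 0 = 0

/-- Class `𝒦_∞`: class `𝒦` and unbounded. -/
def IsKInf (α : ℝ → ℝ) : Prop :=
  IsK α ∧ Tendsto α atTop atTop

/-- Class `𝒦ℒ`. -/
def IsKL (β : ℝ → ℝ → ℝ) : Prop :=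
  ContinuousOn (fun p : ℝ × ℝ => β p.1 p.2) (Ici 0 ×ˢ Ici 0) ∧
  (∀ t, 0 ≤ t → IsK (fun s => β s t)) ∧
  ∀ s, 0 < s → AntitoneOn (β s) (Ici 0) ∧ Tendsto (β s) atTop (𝓝 0)

/-- `α` is a (positive multiple of the) square function on `[0, ∞)`. -/
def IsSquareFun (α : ℝ → ℝ) : Prop :=
  ∃ a : ℝ, 0 < a ∧ ∀ r, 0 ≤ r → α r = a * r ^ 2

/-- `α` is a (positive multiple of the) square root function on `[0, ∞)`. -/
def IsSqrtFun (α : ℝ → ℝ) : Prop :=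
  ∃ a : ℝ, 0 < a ∧ ∀ r, 0 ≤ r → α r = a * √r

/-- `α : ℝ₊ → ℝ₊` is globally Lipschitz. -/
def IsGloballyLipschitz (α : ℝ → ℝ) : Prop :=
  ∃ L : NNReal, LipschitzOnWith L α (Ici 0)

/-- `α : ℝ₊ → ℝ₊` is invertible and its inverse `ℝ₊ → ℝ₊` is globally Lipschitz. -/
def HasGloballyLipschitzInverse (α : ℝ → ℝ) : Prop :=
  ∃ β : ℝ → ℝ, MapsTo α (Ici 0) (Ici 0) ∧ MapsTo β (Ici 0) (Ici 0) ∧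
    InvOn β α (Ici 0) (Ici 0) ∧ IsGloballyLipschitz β

/-! ### Input-to-state stability -/

/-- Measurable, locally essentially bounded inputs on `[0, ∞)`. -/
def IsAdmissibleInput {U : Type*} [NormedAddCommGroup U] (u : ℝ → U) : Prop :=
  ∀ T : ℝ, MemLp u ⊤ (volume.restrict (Icc 0 T))

/-- `ξ` is a (Carathéodory) solution of `ξ' = f(ξ, u)` on `[0, T]`, i.e. it is absolutely
continuous and satisfies the equation almost everywhere; written as an integral equation. -/
def IsSolutionOn {X U : Type*} [NormedAddCommGroup X] [NormedSpace ℝ X]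
    (f : X → U → X) (u : ℝ → U) (ξ : ℝ → X) (T : ℝ) : Prop :=
  IntervalIntegrable (fun s => f (ξ s) (u s)) volume 0 T ∧
  ∀ t ∈ Icc 0 T, ξ t = ξ 0 + ∫ s in (0 : ℝ)..t, f (ξ s) (u s)

/-- The system `ξ' = f(ξ, u)` is input-to-state stable with `ξ - ξe` as the state and `u` as the
input. For every input and every initial state there is a solution on `[0, ∞)`, and every solution
satisfies `|ξ(t) - ξe| ≤ max {β(|ξ(0) - ξe|, t), χ(‖u‖_∞)}`; here `‖u‖_∞` is the essential supremum
over `[0, t]`, which is finite for every admissible input and at most the one over `[0, ∞)`. -/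
def IsISS {X U : Type*} [NormedAddCommGroup X] [NormedSpace ℝ X] [NormedAddCommGroup U]
    (f : X → U → X) (ξe : X) : Prop :=
  ∃ β : ℝ → ℝ → ℝ, ∃ χ : ℝ → ℝ, IsKL β ∧ IsK χ ∧
    ∀ u : ℝ → U, IsAdmissibleInput u →
      (∀ ξ₀ : X, ∃ ξ : ℝ → X, ξ 0 = ξ₀ ∧ ∀ T, 0 ≤ T → IsSolutionOn f u ξ T) ∧
      ∀ (ξ : ℝ → X) (t : ℝ), 0 ≤ t → IsSolutionOn f u ξ t →
        ‖ξ t - ξe‖ ≤ max (β ‖ξ 0 - ξe‖ t)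
          (χ (eLpNorm u ⊤ (volume.restrict (Icc 0 t))).toReal)

/-! ### The singularly perturbed system

`x' = ρs(x,z,d) gs(x,z,d)`, `z' = ρf(z,x,w) gf(z,x,w)`, with state `(x, z)` and input `(d, w)`;
`WithLp 2` puts the Euclidean norm on the pairs. -/

/-- `ℝⁿ` with the Euclidean norm. -/
abbrev Vec (n : ℕ) : Type := EuclideanSpace ℝ (Fin n)

/-- The right-hand side of the perturbed system. -/
def perturbedSystem {n m p q : ℕ}
    (ρs : Vec n → Vec m → Vec p → ℝ) (ρf : Vec m → Vec n → Vec q → ℝ)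
    (gs : Vec n → Vec m → Vec p → Vec n) (gf : Vec m → Vec n → Vec q → Vec m) :
    WithLp 2 (Vec n × Vec m) → WithLp 2 (Vec p × Vec q) → WithLp 2 (Vec n × Vec m) :=
  fun ξ u => WithLp.toLp 2
    (ρs ξ.fst ξ.snd u.fst • gs ξ.fst ξ.snd u.fst, ρf ξ.snd ξ.fst u.snd • gf ξ.snd ξ.fst u.snd)

/-- Regularity of the fast dynamics: locally Lipschitz in `(z, x)` (uniformly for `w` in bounded
sets), Borel measurable and locally bounded in `w`. Functions that are locally Lipschitz in all
variables, or only piecewise continuous in `w`, are covered. -/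
structure IsRegularField {m n q : ℕ} (gf : Vec m → Vec n → Vec q → Vec m) : Prop where
  lipschitz : ∀ R : ℝ, ∃ L : ℝ, ∀ (z z' : Vec m) (x x' : Vec n) (w : Vec q),
    ‖z‖ ≤ R → ‖z'‖ ≤ R → ‖x‖ ≤ R → ‖x'‖ ≤ R → ‖w‖ ≤ R →
      ‖gf z x w - gf z' x' w‖ ≤ L * (‖z - z'‖ + ‖x - x'‖)
  measurable : ∀ (z : Vec m) (x : Vec n), Measurable (gf z x)
  bounded : ∀ R : ℝ, ∃ M : ℝ, ∀ (z : Vec m) (x : Vec n) (w : Vec q),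
    ‖z‖ ≤ R → ‖x‖ ≤ R → ‖w‖ ≤ R → ‖gf z x w‖ ≤ M

/-- The steady-state assumption. -/
structure SteadyState {n m p q : ℕ}
    (gs : Vec n → Vec m → Vec p → Vec n) (gf : Vec m → Vec n → Vec q → Vec m)
    (φ : Vec n → Vec m) : Prop where
  locallyLipschitz : LocallyLipschitz φ
  slow : gs 0 (φ 0) 0 = 0
  fast : ∀ x, gf (φ x) x 0 = 0

/-- The Lyapunov assumption on the reduced-order (slow) subsystem; `αsl`, `αsu` are the lower and
upper bounds of `Vs`. -/
structure SlowLyapunov {n m p : ℕ} (gs : Vec n → Vec m → Vec p → Vec n)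
    (Vs : Vec n → ℝ) (Vf : Vec m → Vec n → ℝ) (αsl αsu γs χs αs : ℝ → ℝ) : Prop where
  contDiff : ContDiff ℝ 1 Vs
  lower_class : IsKInf αsl
  upper_class : IsKInf αsu
  gamma_class : IsKInf γs
  chi_class : IsKInf χs
  alpha_class : IsPD αs
  lower : ∀ x, αsl ‖x‖ ≤ Vs x
  upper : ∀ x, Vs x ≤ αsu ‖x‖
  decrease : ∀ (x : Vec n) (z : Vec m) (d : Vec p),
    max (γs (Vf z x)) (χs ‖d‖) ≤ Vs x → fderiv ℝ Vs x (gs x z d) ≤ -αs (Vs x)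

/-- The Lyapunov assumption on the boundary-layer (fast) subsystem; `αfl`, `αfu` are the lower and
upper bounds of `Vf`. -/
structure FastLyapunov {n m q : ℕ} (gf : Vec m → Vec n → Vec q → Vec m) (φ : Vec n → Vec m)
    (Vs : Vec n → ℝ) (Vf : Vec m → Vec n → ℝ) (αfl αfu χf αf lf1 lf2 : ℝ → ℝ) : Prop where
  contDiff : ContDiff ℝ 1 (fun p : Vec m × Vec n => Vf p.1 p.2)
  lower_class : IsKInf αfl
  upper_class : IsKInf αfu
  chi_class : IsKInf χf
  alpha_class : IsPD αf
  lambda1_class : IsPD lf1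
  lambda2_class : IsPD lf2
  lower : ∀ z x, αfl ‖z - φ x‖ ≤ Vf z x
  upper : ∀ z x, Vf z x ≤ αfu ‖z - φ x‖
  decrease : ∀ (z : Vec m) (x : Vec n) (w : Vec q),
    χf ‖w‖ ≤ Vf z x → fderiv ℝ (fun z' => Vf z' x) z (gf z x w) ≤ -αf (Vf z x)
  cross : ∀ (z : Vec m) (x : Vec n),
    ‖fderiv ℝ (fun x' => Vf z x') x‖ ≤ lf1 (Vf z x) + lf2 (Vs x)

end

/-! ### Absolutely continuous functions -/

/-! Take `c_s = 1` and the Lyapunov function `max (V_s, κ V_f)` with `κ` above the Lipschitz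
constant of `γ_s`. Suppose it exceeds a class `𝒦` function of the input. Where `V_s` attains the
maximum, the small-gain condition `γ_s(V_f) ≤ V_s` holds, so `V_s` decreases. Where `κ V_f` attains
it, `∂V_f/∂z` contributes at most `-c_f α_f(V_f)`, which is at most a negative multiple of `c_f
V_f`. The other contribution is bounded by `|∂V_f/∂x| |g_s|`. Its first factor is `O(√V_f)` because
`V_s ≤ κ V_f`. If `|g_s|` is also `O(√V_f)`, the product is `O(V_f)` and a large `c_f` wins.

The difficulty is this bound on `g_s`. Passing from `g_s(x, z, d)` to `g_s(x, φ(x), 0)` costs a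
multiple of `|z - φ(x)| + |d|`, which is harmless. What remains is `|g_s(x, φ(x), 0)| ≤ C √V_s(x)`,
although `φ` is only locally Lipschitz and `V_s` has no quadratic upper bound. This is
`exists_slow_field_bound`. Follow the flow of `y' = g_s(y, φ(y), 0)` from `x₀`. Since `V_s` does not
increase, the curve stays within a multiple of `√V_s(x₀)` of `x₀`. The function `V_f(φ(x₀), ·)`
measures the distance of `φ(y)` from `φ(x₀)`, and the bound on `∂V_f/∂x` lets its square root grow
only linearly with arc length. Hence the velocity varies slowly, and an initial velocity large
compared with `√V_s(x₀)` would carry the curve too far (`norm_velocity_le_of_variation_le`).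

Stability then follows from `isISS_of_lyapunov_max`, based on a comparison lemma for absolutely
continuous functions (`exists_isKL_decay`) and on the almost everywhere derivative of a maximum. The
same estimate is the a priori bound that makes solutions global; local existence is Picard iteration
for a truncated field. -/

theorem AbsolutelyContinuousOnInterval.of_dist_le_mul {X Y : Type*} [PseudoMetricSpace X]
    [PseudoMetricSpace Y] {f : ℝ → X} {g : ℝ → Y} {a b K : ℝ}
    (hg : AbsolutelyContinuousOnInterval g a b)
    (h : ∀ s ∈ uIcc a b, ∀ t ∈ uIcc a b, dist (f s) (f t) ≤ K * dist (g s) (g t)) :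
    AbsolutelyContinuousOnInterval f a b := by
  have h0 := Tendsto.const_mul K hg
  rw [mul_zero] at h0
  refine squeeze_zero' (Eventually.of_forall fun E => Finset.sum_nonneg fun i _ => dist_nonneg)
    ?_ h0
  filter_upwards [mem_inf_of_right (mem_principal_self _)] with E hE
  rw [Finset.mul_sum]
  exact Finset.sum_le_sum fun i hi => h _ (hE.1 i hi).1 _ (hE.1 i hi).2

theorem AbsolutelyContinuousOnInterval.le_of_deriv_nonpos {f : ℝ → ℝ} {a b : ℝ} (hab : a ≤ b)
    (hf : AbsolutelyContinuousOnInterval f a b)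
    (h : ∀ᵐ t, t ∈ Ioo a b → deriv f t ≤ 0) : f b ≤ f a := by
  have h1 := hf.integral_deriv_eq_sub
  have h2 : 0 ≤ ∫ t in a..b, -deriv f t := by
    refine intervalIntegral.integral_nonneg_of_ae_restrict hab ?_
    rw [← restrict_Ioo_eq_restrict_Icc]
    refine (ae_restrict_iff' measurableSet_Ioo).2 ?_
    filter_upwards [h] with t ht hmem
    simpa using ht hmem
  rw [intervalIntegral.integral_neg, h1] at h2
  linarith

/-- A locally Lipschitz function of an indefinite integral is absolutely continuous. -/
theorem LocallyLipschitz.absolutelyContinuousOnInterval_comp {X Y : Type*} [NormedAddCommGroup X]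
    [NormedSpace ℝ X] [CompleteSpace X] [PseudoMetricSpace Y]
    {W : X → Y} (hW : LocallyLipschitz W) {ξ g : ℝ → X} {T : ℝ} (hT : 0 ≤ T)
    (hg : IntervalIntegrable g volume 0 T)
    (hξ : ∀ t ∈ Icc 0 T, ξ t = ξ 0 + ∫ s in (0 : ℝ)..t, g s) :
    AbsolutelyContinuousOnInterval (fun t => W (ξ t)) 0 T := by
  have hint : ∀ s ∈ Icc 0 T, ∀ t ∈ Icc 0 T, IntervalIntegrable g volume s t := fun s hs t ht =>
    hg.mono_set (by rw [uIcc_of_le hT]; exact uIcc_subset_Icc hs ht)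
  have h0 : (0 : ℝ) ∈ Icc 0 T := ⟨le_rfl, hT⟩
  have hsub : ∀ s ∈ Icc 0 T, ∀ t ∈ Icc 0 T, ξ t - ξ s = ∫ r in s..t, g r := by
    intro s hs t ht
    rw [hξ t ht, hξ s hs, add_sub_add_left_eq_sub,
      intervalIntegral.integral_interval_sub_left (hint 0 h0 t ht) (hint 0 h0 s hs)]
  have hN := hg.norm.absolutelyContinuousOnInterval_intervalIntegral
    (c := 0) (by rw [uIcc_of_le hT]; exact h0)
  have hcurve : AbsolutelyContinuousOnInterval ξ 0 T := by
    refine hN.of_dist_le_mul (K := 1) ?_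
    rw [uIcc_of_le hT]
    intro s hs t ht
    rw [one_mul, dist_comm, dist_eq_norm, hsub s hs t ht, dist_comm, Real.dist_eq,
      intervalIntegral.integral_interval_sub_left (hint 0 h0 t ht).norm (hint 0 h0 s hs).norm]
    exact intervalIntegral.norm_integral_le_abs_integral_norm
  have hcomp : IsCompact (ξ '' Icc 0 T) := by
    have := hcurve.continuousOn
    rw [uIcc_of_le hT] at this
    exact isCompact_Icc.image_of_continuousOn this
  obtain ⟨K, hK⟩ := (hW.locallyLipschitzOn (s := ξ '' Icc 0 T)).exists_lipschitzOnWith_of_compact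
    hcomp
  refine hcurve.of_dist_le_mul (K := K) ?_
  rw [uIcc_of_le hT]
  exact fun s hs t ht => hK.dist_le_mul _ (mem_image_of_mem _ hs) _ (mem_image_of_mem _ ht)

/-! ### Decay estimates -/

/-- An absolutely continuous function that decreases at rate `α` above the level `c` obeys a `𝒦ℒ`
estimate, which depends on `α` only. -/
theorem exists_isKL_decay {α : ℝ → ℝ} (hα : IsPD α) : ∃ β : ℝ → ℝ → ℝ, IsKL β ∧
    ∀ (v : ℝ → ℝ) (T c : ℝ), 0 ≤ T → 0 ≤ c → AbsolutelyContinuousOnInterval v 0 T →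
      (∀ᵐ t, t ∈ Ioo 0 T → c < v t → deriv v t ≤ -α (v t)) → v T ≤ max (β (v 0) T) c := by
  obtain ⟨hαc, hαpos, -⟩ := hα
  -- In the variable `y = log v` the decay reads `y' ≤ -α(exp y) / exp y`, so a primitive `H` of `p`
  -- satisfies `(H ∘ y)' ≤ -1`. The minimum with `exp y` forces `p ≥ 1`, which makes `H` a bijection
  -- of the whole line.
  set p : ℝ → ℝ := fun y => Real.exp y / min (α (Real.exp y)) (Real.exp y) with hp
  have hmpos : ∀ y, 0 < min (α (Real.exp y)) (Real.exp y) := fun y =>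
    lt_min (hαpos _ (Real.exp_pos y)) (Real.exp_pos y)
  have hp1 : ∀ y, 1 ≤ p y := fun y => (one_le_div (hmpos y)).2 (min_le_right _ _)
  have hpc : Continuous p := by
    have : Continuous fun y => α (Real.exp y) :=
      hαc.comp_continuous Real.continuous_exp fun y => (Real.exp_pos y).le
    exact Real.continuous_exp.div (this.min Real.continuous_exp) fun y => (hmpos y).ne'
  set H : ℝ → ℝ := fun y => ∫ s in (0 : ℝ)..y, p s with hH
  have hHd : ∀ y, HasDerivAt H (p y) y := fun y =>
    intervalIntegral.integral_hasDerivAt_right (hpc.intervalIntegrable _ _)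
      (hpc.stronglyMeasurableAtFilter _ _) hpc.continuousAt
  have hHc : Continuous H := continuous_iff_continuousAt.2 fun y => (hHd y).continuousAt
  have hH1 : ContDiff ℝ 1 H := by
    rw [contDiff_one_iff_deriv]
    refine ⟨fun y => (hHd y).differentiableAt, ?_⟩
    rwa [show deriv H = p from funext fun y => (hHd y).deriv]
  have hHmono : Monotone fun y => H y - y := by
    refine monotone_of_hasDerivAt_nonneg (f' := fun y => p y - 1)
      (fun y => (hHd y).sub (hasDerivAt_id y)) fun y => ?_
    simpa using hp1 y
  have hHstrict : StrictMono H := fun a b hab => by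
    have := hHmono hab.le
    simp only at this
    linarith
  have hH0 : H 0 = 0 := by simp [hH]
  have hHtop : Tendsto H atTop atTop := by
    refine tendsto_atTop_mono' _ ?_ tendsto_id
    filter_upwards [eventually_ge_atTop 0] with y hy
    have := hHmono hy
    simp only [hH0] at this
    simp only [id]
    linarith
  have hHbot : Tendsto H atBot atBot := by
    refine tendsto_atBot_mono' _ ?_ tendsto_id
    filter_upwards [eventually_le_atBot 0] with y hy
    have := hHmono hy
    simp only [hH0] at this
    simp only [id]
    linarith
  set e : ℝ ≃o ℝ := hHstrict.orderIsoOfSurjective H (hHc.surjective hHtop hHbot)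
  have hinv : ∀ y, e.symm (H y) = y := fun y => e.symm_apply_apply y
  have hec : Continuous e.symm := e.symm.continuous
  -- The value at time `t` of the solution of `(H (log v))' = -1` starting at `s`; `s ≤ 0` is
  -- separated because of the logarithm.
  set β : ℝ → ℝ → ℝ := fun s t => if s ≤ 0 then 0 else Real.exp (e.symm (H (Real.log s) - t))
    with hβ
  have hβ0 : ∀ t, β 0 t = 0 := fun t => by simp [hβ]
  have hβpos : ∀ s t, 0 < s → β s t = Real.exp (e.symm (H (Real.log s) - t)) := fun s t hs => by
    simp [hβ, not_le.2 hs]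
  have hβle : ∀ s t, 0 ≤ s → 0 ≤ t → 0 ≤ β s t ∧ β s t ≤ s := by
    intro s t hs ht
    rcases hs.eq_or_lt with rfl | hs
    · simp [hβ0]
    · rw [hβpos s t hs]
      refine ⟨(Real.exp_pos _).le, ?_⟩
      calc _ ≤ Real.exp (e.symm (H (Real.log s))) :=
            Real.exp_le_exp.2 (e.symm.monotone (by linarith))
        _ = s := by rw [hinv, Real.exp_log hs]
  have hcont : ContinuousOn (fun p : ℝ × ℝ => β p.1 p.2) (Ici 0 ×ˢ Ici 0) := by
    rintro ⟨s, t⟩ ⟨hs, ht⟩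
    rcases (show 0 ≤ s from hs).eq_or_lt with rfl | hs
    · have : Tendsto (fun p : ℝ × ℝ => β p.1 p.2) (𝓝[Ici 0 ×ˢ Ici 0] ((0 : ℝ), t)) (𝓝 0) := by
        refine squeeze_zero' (g := fun p : ℝ × ℝ => p.1) ?_ ?_ ?_
        · filter_upwards [self_mem_nhdsWithin] with q hq using (hβle _ _ hq.1 hq.2).1
        · filter_upwards [self_mem_nhdsWithin] with q hq using (hβle _ _ hq.1 hq.2).2
        · exact tendsto_nhdsWithin_of_tendsto_nhds (continuous_fst.tendsto' _ _ rfl)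
      simpa [ContinuousWithinAt, hβ0] using this
    · refine ContinuousAt.continuousWithinAt ?_
      have hev : (fun p : ℝ × ℝ => β p.1 p.2) =ᶠ[𝓝 (s, t)]
          fun p => Real.exp (e.symm (H (Real.log p.1) - p.2)) := by
        filter_upwards [(isOpen_lt continuous_const continuous_fst).mem_nhds
          (show (0 : ℝ) < (s, t).1 from hs)] with q hq using hβpos _ _ hq
      refine ContinuousAt.congr ?_ hev.symm
      refine Real.continuous_exp.continuousAt.comp (hec.continuousAt.comp ?_)
      refine ContinuousAt.sub (hHc.continuousAt.comp ?_) continuousAt_snd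
      exact continuousAt_fst.log hs.ne'
  refine ⟨β, ⟨hcont, fun t ht => ⟨?_, ?_, hβ0 t⟩, fun s hs => ⟨?_, ?_⟩⟩, ?_⟩
  · exact hcont.comp (f := fun s => (s, t)) (by fun_prop) fun s hs => ⟨hs, ht⟩
  · intro a ha b hb hab
    have hb0 : 0 < b := lt_of_le_of_lt (show 0 ≤ a from ha) hab
    simp only [hβpos b t hb0]
    rcases (show 0 ≤ a from ha).eq_or_lt with rfl | ha
    · rw [hβ0]; exact Real.exp_pos _
    · rw [hβpos a t ha, Real.exp_lt_exp, e.symm.lt_iff_lt, sub_lt_sub_iff_right, hHstrict.lt_iff_lt]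
      exact Real.log_lt_log ha hab
  · intro a _ b _ hab
    rw [hβpos s _ hs, hβpos s _ hs, Real.exp_le_exp, e.symm.le_iff_le]
    linarith
  · rw [show β s = fun t => Real.exp (e.symm (H (Real.log s) - t)) from
      funext fun t => hβpos s t hs]
    refine Real.tendsto_exp_atBot.comp (e.symm.tendsto_atBot.comp ?_)
    exact (tendsto_const_nhds.add_atBot tendsto_neg_atTop_atBot).congr fun t =>
      (sub_eq_add_neg _ _).symm
  · intro v T c hT hc hv hdec
    by_contra! hlt
    obtain ⟨hlt1, hlt2⟩ := max_lt_iff.1 hlt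
    have hvc : ContinuousOn v (Icc 0 T) := by simpa [uIcc_of_le hT] using hv.continuousOn
    -- After the last time at which `v ≤ c`, the function could only decrease, so it could not end
    -- above `c`.
    have habove : ∀ s ∈ Icc 0 T, c < v s := by
      by_contra! hex
      have hcomp : IsCompact (Icc 0 T ∩ v ⁻¹' Iic c) :=
        isCompact_Icc.of_isClosed_subset (hvc.preimage_isClosed_of_isClosed isClosed_Icc isClosed_Iic)
          inter_subset_left
      obtain ⟨s, ⟨hs, hsc⟩, hmax⟩ := hcomp.exists_isGreatest
        (let ⟨s, hs, h⟩ := hex; ⟨s, hs, h⟩)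
      have hle : v T ≤ v s := by
        refine (hv.mono ?_).le_of_deriv_nonpos hs.2 ?_
        · rw [uIcc_of_le hT, uIcc_of_le hs.2]; exact Icc_subset_Icc_left hs.1
        · filter_upwards [hdec] with t ht htm
          have htc : c < v t := by
            by_contra! hcon
            exact absurd (hmax ⟨⟨hs.1.trans htm.1.le, htm.2.le⟩, hcon⟩) (not_le.2 htm.1)
          have := ht ⟨hs.1.trans_lt htm.1, htm.2⟩ htc
          have := hαpos _ (hc.trans_lt htc)
          linarith
      exact absurd (hle.trans hsc) (not_le.2 hlt2)
    have hpos : ∀ s ∈ Icc 0 T, 0 < v s := fun s hs => hc.trans_lt (habove s hs)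
    have h0 : (0 : ℝ) ∈ Icc 0 T := ⟨le_rfl, hT⟩
    have hT' : T ∈ Icc 0 T := ⟨hT, le_rfl⟩
    obtain ⟨a, ha, hamin⟩ := isCompact_Icc.exists_isMinOn ⟨0, h0⟩ hvc
    obtain ⟨b, hb, hbmax⟩ := isCompact_Icc.exists_isMaxOn ⟨0, h0⟩ hvc
    have hL : ∃ K, LipschitzOnWith K (fun r => H (Real.log r)) (Icc (v a) (v b)) := by
      refine ContDiffOn.exists_lipschitzOnWith (n := 1) ?_ (by simp) (convex_Icc _ _)
        isCompact_Icc
      refine hH1.comp_contDiffOn (ContDiffOn.log contDiffOn_id fun x hx => ?_)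
      exact ((hpos a ha).trans_le hx.1).ne'
    obtain ⟨K, hK⟩ := hL
    have hac1 : AbsolutelyContinuousOnInterval (fun t => H (Real.log (v t))) 0 T := by
      refine hv.of_dist_le_mul (K := K) ?_
      rw [uIcc_of_le hT]
      exact fun s hs t ht => hK.dist_le_mul _ ⟨hamin hs, hbmax hs⟩ _ ⟨hamin ht, hbmax ht⟩
    have hac2 : AbsolutelyContinuousOnInterval (fun t : ℝ => t) 0 T :=
      contDiffOn_id.absolutelyContinuousOnInterval
    have key := (hac1.add hac2).le_of_deriv_nonpos hT (by
      filter_upwards [hdec, hv.ae_differentiableAt] with t ht htd htm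
      have htI : t ∈ Icc 0 T := Ioo_subset_Icc_self htm
      have hvt := hpos t htI
      have hd := (htd (by rwa [uIcc_of_le hT])).hasDerivAt
      have h1 := ((hHd _).comp t (hd.log hvt.ne')).add (hasDerivAt_id t)
      have h2 : deriv ((fun t => H (Real.log (v t))) + fun t => t) t
        = p (Real.log (v t)) * (deriv v t / v t) + 1 := h1.deriv
      rw [h2, hp]
      simp only [Real.exp_log hvt]
      have h3 := ht htm (habove t htI)
      have hm : 0 < min (α (v t)) (v t) := lt_min (hαpos _ hvt) hvt
      have h4 : v t / min (α (v t)) (v t) * (deriv v t / v t)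
        = deriv v t / min (α (v t)) (v t) := by field_simp
      rw [h4]
      have h5 : deriv v t / min (α (v t)) (v t) ≤ -1 := by
        rw [div_le_iff₀ hm]
        have := min_le_left (α (v t)) (v t)
        linarith
      linarith)
    simp only [Pi.add_apply, add_zero] at key
    have h6 : v T ≤ β (v 0) T := by
      rw [hβpos _ _ (hpos 0 h0), ← Real.exp_log (hpos T hT'), Real.exp_le_exp, ← hinv (Real.log (v T)),
        e.symm.le_iff_le]
      linarith
    exact absurd h6 (not_le.2 hlt1)

/-! ### Lyapunov functions given as a maximum -/

theorem IsSolutionOn.mono {X U : Type*} [NormedAddCommGroup X] [NormedSpace ℝ X]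
    {f : X → U → X} {u : ℝ → U} {ξ : ℝ → X} {S T : ℝ} (h : IsSolutionOn f u ξ T)
    (hS : 0 ≤ S) (hST : S ≤ T) : IsSolutionOn f u ξ S :=
  ⟨h.1.mono_set (by
    rw [uIcc_of_le hS, uIcc_of_le (hS.trans hST)]; exact Icc_subset_Icc_right hST),
    fun t ht => h.2 t ⟨ht.1, ht.2.trans hST⟩⟩

theorem IsSolutionOn.ae_hasDerivAt {X U : Type*} [NormedAddCommGroup X] [NormedSpace ℝ X]
    [CompleteSpace X] {f : X → U → X} {u : ℝ → U} {ξ : ℝ → X} {T : ℝ} (hT : 0 ≤ T)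
    (h : IsSolutionOn f u ξ T) :
    ∀ᵐ t, t ∈ Ioo 0 T → HasDerivAt ξ (f (ξ t) (u t)) t := by
  filter_upwards [h.1.ae_hasDerivAt_integral] with t ht htm
  rw [uIcc_of_le hT] at ht
  refine ((ht (Ioo_subset_Icc_self htm) 0 ⟨le_rfl, hT⟩).const_add (ξ 0)).congr_of_eventuallyEq ?_
  filter_upwards [Ioo_mem_nhds htm.1 htm.2] with s hs using h.2 s (Ioo_subset_Icc_self hs)

/-- Along a solution, the derivative of the maximum of two continuously differentiable functions is
almost everywhere the derivative of either one that attains the maximum. -/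
theorem IsSolutionOn.ae_deriv_max {X U : Type*} [NormedAddCommGroup X] [NormedSpace ℝ X]
    [CompleteSpace X] {f : X → U → X} {u : ℝ → U} {ξ : ℝ → X} {T : ℝ} (hT : 0 ≤ T)
    (h : IsSolutionOn f u ξ T) {V W : X → ℝ} (hV : ContDiff ℝ 1 V) (hW : ContDiff ℝ 1 W) :
    AbsolutelyContinuousOnInterval (fun t => max (V (ξ t)) (W (ξ t))) 0 T ∧
    ∀ᵐ t, t ∈ Ioo 0 T →
      (W (ξ t) ≤ V (ξ t) →
        deriv (fun t => max (V (ξ t)) (W (ξ t))) t = fderiv ℝ V (ξ t) (f (ξ t) (u t))) ∧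
      (V (ξ t) ≤ W (ξ t) →
        deriv (fun t => max (V (ξ t)) (W (ξ t))) t = fderiv ℝ W (ξ t) (f (ξ t) (u t))) := by
  have hac : AbsolutelyContinuousOnInterval (fun t => max (V (ξ t)) (W (ξ t))) 0 T :=
    LocallyLipschitz.absolutelyContinuousOnInterval_comp (W := fun x => max (V x) (W x))
      (hV.locallyLipschitz.max hW.locallyLipschitz) hT h.1 h.2
  refine ⟨hac, ?_⟩
  have key : ∀ (t : ℝ) (Z : X → ℝ), ContDiff ℝ 1 Z → HasDerivAt ξ (f (ξ t) (u t)) t →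
      DifferentiableAt ℝ (fun t => max (V (ξ t)) (W (ξ t))) t →
      (∀ x, Z x ≤ max (V x) (W x)) → max (V (ξ t)) (W (ξ t)) = Z (ξ t) →
      deriv (fun t => max (V (ξ t)) (W (ξ t))) t = fderiv ℝ Z (ξ t) (f (ξ t) (u t)) := by
    intro t Z hZ hξ hd hle heq
    have h1 := ((hZ.differentiable (by simp)) (ξ t)).hasFDerivAt.comp_hasDerivAt t hξ
    have h2 := hd.hasDerivAt.sub h1
    -- The maximum minus the active function is nonnegative and vanishes at `t`, so its derivative
    -- there is zero.
    have hmin : IsLocalMin ((fun t => max (V (ξ t)) (W (ξ t))) - (Z ∘ ξ)) t := by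
      refine Eventually.of_forall fun s => ?_
      simp only [Pi.sub_apply, Function.comp, heq, sub_self]
      exact sub_nonneg.2 (hle _)
    linarith [hmin.hasDerivAt_eq_zero h2]
  filter_upwards [h.ae_hasDerivAt hT, hac.ae_differentiableAt] with t ht htd htm
  have htd := htd (by rw [uIcc_of_le hT]; exact Ioo_subset_Icc_self htm)
  exact ⟨fun hle => key t V hV (ht htm) htd (fun x => le_max_left _ _) (max_eq_left hle),
    fun hle => key t W hW (ht htm) htd (fun x => le_max_right _ _) (max_eq_right hle)⟩

/-! ### Existence and uniqueness of Carathéodory solutions -/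

/-- Locally Lipschitz in the state, uniformly for bounded inputs, measurable in the input and
locally bounded. -/
structure IsCaratheodoryField {X U : Type*} [NormedAddCommGroup X] [MeasurableSpace X]
    [NormedAddCommGroup U] [MeasurableSpace U] (f : X → U → X) : Prop where
  lipschitz : ∀ R : ℝ, ∃ L : ℝ, ∀ ξ η v, ‖ξ‖ ≤ R → ‖η‖ ≤ R → ‖v‖ ≤ R →
    ‖f ξ v - f η v‖ ≤ L * ‖ξ - η‖
  measurable : ∀ ξ, Measurable (f ξ)
  bounded : ∀ R : ℝ, ∃ M : ℝ, ∀ ξ v, ‖ξ‖ ≤ R → ‖v‖ ≤ R → ‖f ξ v‖ ≤ M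

theorem IsAdmissibleInput.exists_bound {U : Type*} [NormedAddCommGroup U] {u : ℝ → U}
    (hu : IsAdmissibleInput u) (T : ℝ) :
    0 ≤ (eLpNorm u ⊤ (volume.restrict (Icc 0 T))).toReal ∧ ∀ᵐ s, s ∈ Icc 0 T →
      ‖u s‖ ≤ (eLpNorm u ⊤ (volume.restrict (Icc 0 T))).toReal := by
  refine ⟨ENNReal.toReal_nonneg, ?_⟩
  have h := hu T
  have h1 := ae_le_eLpNormEssSup (f := u) (μ := volume.restrict (Icc 0 T))
  rw [ae_restrict_iff' measurableSet_Icc] at h1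
  filter_upwards [h1] with s hs hmem
  have h2 := ENNReal.toReal_mono (by simpa using h.2.ne) (hs hmem)
  simpa using h2

theorem aestronglyMeasurable_field_comp {X U : Type*} [NormedAddCommGroup X]
    [SecondCountableTopology X] [MeasurableSpace X] [BorelSpace X]
    [NormedAddCommGroup U] [MeasurableSpace U] [BorelSpace U]
    {f : X → U → X} (hf : Measurable (Function.uncurry f))
    {μ : Measure ℝ} {u : ℝ → U} (hu : AEStronglyMeasurable u μ) {ξ : ℝ → X}
    (hξ : AEStronglyMeasurable ξ μ) : AEStronglyMeasurable (fun s => f (ξ s) (u s)) μ :=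
  (hf.comp_aemeasurable (hξ.aemeasurable.prodMk hu.aemeasurable)).aestronglyMeasurable

theorem IsSolutionOn.continuousOn {X U : Type*} [NormedAddCommGroup X] [NormedSpace ℝ X]
    {f : X → U → X} {u : ℝ → U} {ξ : ℝ → X} {T : ℝ} (hT : 0 ≤ T)
    (h : IsSolutionOn f u ξ T) : ContinuousOn ξ (Icc 0 T) := by
  have h1 := intervalIntegral.continuousOn_primitive_interval (a := 0) (b := T)
    (f := fun s => f (ξ s) (u s)) (μ := volume) (by
      rw [uIcc_of_le hT, ← intervalIntegrable_iff_integrableOn_Icc_of_le hT]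
      exact h.1)
  rw [uIcc_of_le hT] at h1
  exact (continuousOn_const.add h1).congr h.2

theorem IsSolutionOn.congr {X U : Type*} [NormedAddCommGroup X] [NormedSpace ℝ X]
    {f : X → U → X} {u : ℝ → U} {ξ η : ℝ → X} {T : ℝ} (hT : 0 ≤ T)
    (h : IsSolutionOn f u ξ T) (heq : EqOn η ξ (Icc 0 T)) : IsSolutionOn f u η T := by
  have h2 : EqOn (fun s => f (η s) (u s)) (fun s => f (ξ s) (u s)) (Icc 0 T) := fun s hs => by
    simp only [heq hs]
  refine ⟨h.1.congr ?_, fun t ht => ?_⟩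
  · rw [uIoc_of_le hT]
    exact fun s hs => (h2 (Ioc_subset_Icc_self hs)).symm
  · rw [heq ht, heq ⟨le_rfl, hT⟩, h.2 t ht]
    congr 1
    refine intervalIntegral.integral_congr fun s hs => ?_
    rw [uIcc_of_le ht.1] at hs
    exact (h2 (Icc_subset_Icc_right ht.2 hs)).symm

/-- Both solutions and the input stay in a bounded set, where one Lipschitz constant works;
Grönwall's inequality is applied to the primitive of the distance `w`, which is differentiable
everywhere although the solutions need not be. -/
theorem IsCaratheodoryField.eqOn_of_isSolutionOn {X U : Type*} [NormedAddCommGroup X]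
    [NormedSpace ℝ X] [MeasurableSpace X] [NormedAddCommGroup U] [MeasurableSpace U]
    {f : X → U → X} (hf : IsCaratheodoryField f)
    {u : ℝ → U} (hu : IsAdmissibleInput u) {ξ η : ℝ → X} {T : ℝ} (hT : 0 ≤ T)
    (hξ : IsSolutionOn f u ξ T) (hη : IsSolutionOn f u η T) (h0 : ξ 0 = η 0) :
    EqOn ξ η (Icc 0 T) := by
  have hξc := hξ.continuousOn hT
  have hηc := hη.continuousOn hT
  obtain ⟨R1, hR1⟩ := isCompact_Icc.exists_bound_of_continuousOn hξc
  obtain ⟨R2, hR2⟩ := isCompact_Icc.exists_bound_of_continuousOn hηc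
  obtain ⟨hr0, hur⟩ := hu.exists_bound T
  set r := (eLpNorm u ⊤ (volume.restrict (Icc 0 T))).toReal
  obtain ⟨L, hL⟩ := hf.lipschitz (max (max R1 R2) r)
  set w : ℝ → ℝ := fun s => ‖ξ (projIcc 0 T hT s) - η (projIcc 0 T hT s)‖ with hw
  have hproj : ∀ s ∈ Icc 0 T, (projIcc 0 T hT s : ℝ) = s := fun s hs => by
    rw [projIcc_of_mem hT hs]
  have hwc : Continuous w := by
    refine Continuous.norm (Continuous.sub ?_ ?_)
    · exact hξc.comp_continuous (continuous_subtype_val.comp continuous_projIcc) fun s => Subtype.coe_prop _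
    · exact hηc.comp_continuous (continuous_subtype_val.comp continuous_projIcc) fun s => Subtype.coe_prop _
  have hwle : ∀ t ∈ Icc 0 T, w t ≤ L * ∫ s in (0 : ℝ)..t, w s := by
    intro t ht
    have hint : ∀ {ζ}, IsSolutionOn f u ζ T →
        IntervalIntegrable (fun s => f (ζ s) (u s)) volume 0 t := fun h =>
      (h.mono ht.1 ht.2).1
    rw [hw]
    simp only [hproj t ht]
    rw [hξ.2 t ht, hη.2 t ht, h0, add_sub_add_left_eq_sub,
      ← intervalIntegral.integral_sub (hint hξ) (hint hη), ← intervalIntegral.integral_const_mul]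
    refine intervalIntegral.norm_integral_le_of_norm_le ht.1 ?_
      ((hwc.const_mul L).intervalIntegrable _ _)
    filter_upwards [hur] with s hs hmem
    have hsT : s ∈ Icc 0 T := ⟨hmem.1.le, hmem.2.trans ht.2⟩
    simp only [hproj s hsT]
    exact hL _ _ _ ((hR1 s hsT).trans ((le_max_left _ _).trans (le_max_left _ _)))
      ((hR2 s hsT).trans ((le_max_right _ _).trans (le_max_left _ _)))
      ((hs hsT).trans (le_max_right _ _))
  have hd : ∀ t, HasDerivAt (fun t => ∫ s in (0 : ℝ)..t, w s) (w t) t := fun t =>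
    intervalIntegral.integral_hasDerivAt_right (hwc.intervalIntegrable _ _)
      (hwc.stronglyMeasurableAtFilter _ _) hwc.continuousAt
  have hw0 : ∀ t, 0 ≤ w t := fun t => norm_nonneg _
  have hg := norm_le_gronwallBound_of_norm_deriv_right_le (δ := 0) (K := L) (ε := 0)
    (f := fun t => ∫ s in (0 : ℝ)..t, w s) (f' := w) (a := 0) (b := T)
    (fun t _ => (hd t).continuousAt.continuousWithinAt) (fun t _ => (hd t).hasDerivWithinAt)
    (by simp) (fun t ht => by
      rw [Real.norm_of_nonneg (hw0 t), Real.norm_of_nonneg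
        (intervalIntegral.integral_nonneg ht.1 fun s _ => hw0 s), add_zero]
      exact hwle t (Ico_subset_Icc_self ht))
  intro t ht
  have h1 := hg t ht
  rw [gronwallBound_ε0_δ0, norm_le_zero_iff] at h1
  have h2 := hwle t ht
  rw [h1, mul_zero] at h2
  have h3 : w t = 0 := le_antisymm h2 (hw0 t)
  simp only [hw, hproj t ht, norm_eq_zero] at h3
  exact sub_eq_zero.1 h3

section Existence

variable {X U : Type*} [NormedAddCommGroup X] [NormedSpace ℝ X] [CompleteSpace X]
  [SecondCountableTopology X] [MeasurableSpace X] [BorelSpace X]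
  [NormedAddCommGroup U] [MeasurableSpace U] [BorelSpace U]

/-- Picard iteration for a globally Lipschitz field. -/
theorem exists_isSolutionOn_of_lipschitz {f : X → U → X}
    (hfm : Measurable (Function.uncurry f)) {u : ℝ → U} {T r L M : ℝ} (hT : 0 ≤ T)
    (hu : AEStronglyMeasurable u (volume.restrict (Icc 0 T)))
    (hur : ∀ᵐ s, s ∈ Icc 0 T → ‖u s‖ ≤ r)
    (hL : ∀ ξ η v, ‖v‖ ≤ r → ‖f ξ v - f η v‖ ≤ L * ‖ξ - η‖)
    (hM : ∀ ξ v, ‖v‖ ≤ r → ‖f ξ v‖ ≤ M) (ξ₀ : X) :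
    ∃ ξ : ℝ → X, Continuous ξ ∧ ξ 0 = ξ₀ ∧ IsSolutionOn f u ξ T := by
  wlog hL0 : 0 ≤ L generalizing L
  · refine this (L := max L 0) (fun ξ η v hv => (hL ξ η v hv).trans ?_) (le_max_right _ _)
    exact mul_le_mul_of_nonneg_right (le_max_left _ _) (norm_nonneg _)
  have h0 : (0 : ℝ) ∈ Icc 0 T := ⟨le_rfl, hT⟩
  have hint : ∀ ξ : ℝ → X, Continuous ξ → ∀ t ∈ Icc 0 T,
      IntervalIntegrable (fun s => f (ξ s) (u s)) volume 0 t := by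
    intro ξ hξ t ht
    have h1 : IntegrableOn (fun s => f (ξ s) (u s)) (Icc 0 T) := by
      refine Integrable.of_bound
        (aestronglyMeasurable_field_comp hfm hu hξ.aestronglyMeasurable) M ?_
      rw [ae_restrict_iff' measurableSet_Icc]
      filter_upwards [hur] with s hs hm using hM _ _ (hs hm)
    rw [intervalIntegrable_iff_integrableOn_Icc_of_le ht.1]
    exact h1.mono_set (Icc_subset_Icc_right ht.2)
  let ext : C(Icc 0 T, X) → ℝ → X := fun ξ s => ξ (projIcc 0 T hT s)
  have hext : ∀ ξ, Continuous (ext ξ) := fun ξ => ξ.continuous.comp continuous_projIcc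
  have hP : ∀ ξ : C(Icc 0 T, X),
      Continuous fun t : Icc 0 T => ξ₀ + ∫ s in (0 : ℝ)..t, f (ext ξ s) (u s) := by
    intro ξ
    refine continuous_const.add ?_
    have h1 := intervalIntegral.continuousOn_primitive_interval (a := 0) (b := T)
      (f := fun s => f (ext ξ s) (u s)) (μ := volume) (by
        rw [uIcc_of_le hT, ← intervalIntegrable_iff_integrableOn_Icc_of_le hT]
        exact hint _ (hext ξ) T ⟨hT, le_rfl⟩)
    rw [uIcc_of_le hT] at h1
    exact h1.domRestrict
  let P : C(Icc 0 T, X) → C(Icc 0 T, X) := fun ξ => ⟨_, hP ξ⟩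
  have hPa : ∀ ξ t, P ξ t = ξ₀ + ∫ s in (0 : ℝ)..t, f (ext ξ s) (u s) := fun _ _ => rfl
  -- The factorial makes some iterate of the Picard map a contraction on all of `[0, T]`, with no
  -- need to shorten the interval.
  have hiter : ∀ (k : ℕ) (ξ η : C(Icc 0 T, X)) (t : Icc 0 T),
      ‖P^[k] ξ t - P^[k] η t‖ ≤ (L * t) ^ k / k.factorial * dist ξ η := by
    intro k ξ η
    induction k with
    | zero =>
      intro t
      simpa [← dist_eq_norm] using ContinuousMap.dist_apply_le_dist (f := ξ) (g := η) t
    | succ k ih =>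
      intro t
      rw [Function.iterate_succ_apply', Function.iterate_succ_apply', hPa, hPa,
        add_sub_add_left_eq_sub, ← intervalIntegral.integral_sub (hint _ (hext _) t t.2)
          (hint _ (hext _) t t.2)]
      have h1 : ‖∫ s in (0 : ℝ)..t, (f (ext (P^[k] ξ) s) (u s) - f (ext (P^[k] η) s) (u s))‖
          ≤ ∫ s in (0 : ℝ)..t, L ^ (k + 1) / k.factorial * dist ξ η * s ^ k := by
        refine intervalIntegral.norm_integral_le_of_norm_le t.2.1 ?_ ?_
        · filter_upwards [hur] with s hs hmem
          have hsT : s ∈ Icc 0 T := ⟨hmem.1.le, hmem.2.trans t.2.2⟩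
          refine (hL _ _ _ (hs hsT)).trans ?_
          have h2 := ih (projIcc 0 T hT s)
          rw [projIcc_of_mem hT hsT] at h2
          have h3 : ∀ ζ, ext ζ s = ζ ⟨s, hsT⟩ := fun ζ => by
            simp only [ext, projIcc_of_mem hT hsT]
          rw [h3, h3]
          refine (mul_le_mul_of_nonneg_left h2 hL0).trans (le_of_eq ?_)
          simp only [mul_pow, pow_succ]
          ring
        · exact (continuous_const.mul (continuous_id.pow k)).intervalIntegrable _ _
      refine h1.trans (le_of_eq ?_)
      rw [intervalIntegral.integral_const_mul, integral_pow, Nat.factorial_succ]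
      push_cast
      have : (k.factorial : ℝ) ≠ 0 := by positivity
      field_simp
      ring
  obtain ⟨k, hk⟩ := (FloorSemiring.tendsto_pow_div_factorial_atTop (L * T)).eventually
    (gt_mem_nhds zero_lt_one) |>.exists
  have hc0 : 0 ≤ (L * T) ^ k / k.factorial := by positivity
  have hcontr : ContractingWith ⟨(L * T) ^ k / k.factorial, hc0⟩ P^[k] := by
    refine ⟨by exact_mod_cast hk, LipschitzWith.of_dist_le_mul fun ξ η => ?_⟩
    rw [ContinuousMap.dist_le (by positivity)]
    intro t
    rw [dist_eq_norm]
    refine (hiter k ξ η t).trans ?_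
    have ht0 : 0 ≤ (t : ℝ) := t.2.1
    have htT : (t : ℝ) ≤ T := t.2.2
    change _ ≤ (L * T) ^ k / k.factorial * dist ξ η
    gcongr
  have hfix := hcontr.isFixedPt_fixedPoint_iterate
  set ζ := hcontr.fixedPoint P^[k]
  have hζ : ∀ t ∈ Icc 0 T, ext ζ t = ξ₀ + ∫ s in (0 : ℝ)..t, f (ext ζ s) (u s) := by
    intro t ht
    have h1 := congrArg (fun η : C(Icc 0 T, X) => η ⟨t, ht⟩) hfix
    simp only [hPa] at h1
    simp only [ext, projIcc_of_mem hT ht]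
    exact h1.symm
  have hζ0 : ext ζ 0 = ξ₀ := by simpa using hζ 0 h0
  exact ⟨ext ζ, hext ζ, hζ0, hint _ (hext ζ) T ⟨hT, le_rfl⟩, by rwa [hζ0]⟩

/-- A priori bounds give a solution on a given interval. -/
theorem IsCaratheodoryField.exists_isSolutionOn {f : X → U → X} (hf : IsCaratheodoryField f)
    {u : ℝ → U} (hu : IsAdmissibleInput u) {ξ₀ : X} {T R : ℝ} (hT : 0 ≤ T)
    (hR : ∀ (ξ : ℝ → X) (t : ℝ), t ∈ Icc 0 T → ξ 0 = ξ₀ → IsSolutionOn f u ξ t → ‖ξ t‖ ≤ R) :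
    ∃ ξ : ℝ → X, ξ 0 = ξ₀ ∧ IsSolutionOn f u ξ T := by
  obtain ⟨hr0, hur⟩ := hu.exists_bound T
  set r := (eLpNorm u ⊤ (volume.restrict (Icc 0 T))).toReal
  set ρ := max (R + 2) r with hρ
  obtain ⟨L, hL⟩ := hf.lipschitz ρ
  obtain ⟨M, hM⟩ := hf.bounded ρ
  -- A cutoff equal to one up to radius `R + 1` and to zero beyond `R + 2`, which makes the field
  -- globally Lipschitz and bounded for the inputs that occur. The a priori bound `R` will show that
  -- the truncation is never felt.
  set θ : X → ℝ := fun ξ => max 0 (min 1 (R + 2 - ‖ξ‖)) with hθ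
  have hθ0 : ∀ ξ, 0 ≤ θ ξ := fun ξ => le_max_left _ _
  have hθ1 : ∀ ξ, θ ξ ≤ 1 := fun ξ => max_le zero_le_one (min_le_left _ _)
  have hθL : ∀ ξ η, |θ ξ - θ η| ≤ ‖ξ - η‖ := by
    intro ξ η
    refine (abs_max_sub_max_le_max _ _ _ _).trans ?_
    rw [sub_self, abs_zero, max_eq_right (abs_nonneg _)]
    refine (abs_min_sub_min_le_max _ _ _ _).trans ?_
    rw [sub_self, abs_zero, max_eq_right (abs_nonneg _), sub_sub_sub_cancel_left, abs_sub_comm]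
    exact abs_norm_sub_norm_le _ _
  have hθin : ∀ ξ, ‖ξ‖ ≤ R + 1 → θ ξ = 1 := by
    intro ξ hξ
    rw [hθ]
    simp only
    rw [min_eq_left (by linarith), max_eq_right zero_le_one]
  have hθout : ∀ ξ, R + 2 < ‖ξ‖ → θ ξ = 0 := fun ξ hξ =>
    max_eq_left ((min_le_right _ _).trans (by linarith))
  set F : X → U → X := fun ξ v => θ ξ • f ξ v with hF
  have hF0 : ∀ ξ v, R + 2 < ‖ξ‖ → F ξ v = 0 := fun ξ v hξ => by simp [hF, hθout ξ hξ]
  have hθf : ∀ ξ η v, ‖ξ‖ ≤ R + 2 → ‖v‖ ≤ ρ → ‖(θ ξ - θ η) • f ξ v‖ ≤ |M| * ‖ξ - η‖ := by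
    intro ξ η v hξ hv
    rw [norm_smul, Real.norm_eq_abs, mul_comm]
    exact mul_le_mul ((hM ξ v (hξ.trans (le_max_left _ _)) hv).trans (le_abs_self _)) (hθL ξ η)
      (abs_nonneg _) (abs_nonneg _)
  have hFL' : ∀ ξ η v, ‖v‖ ≤ ρ → ‖ξ‖ ≤ R + 2 → ‖F ξ v - F η v‖ ≤ (|L| + |M|) * ‖ξ - η‖ := by
    intro ξ η v hv hξ
    rcases le_or_gt ‖η‖ (R + 2) with hη | hη
    · have h1 : F ξ v - F η v = θ η • (f ξ v - f η v) + (θ ξ - θ η) • f ξ v := by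
        simp only [hF, smul_sub, sub_smul]; abel
      rw [h1, add_mul]
      refine (norm_add_le _ _).trans (add_le_add ?_ (hθf ξ η v hξ hv))
      rw [norm_smul, Real.norm_of_nonneg (hθ0 η)]
      calc θ η * ‖f ξ v - f η v‖ ≤ 1 * ‖f ξ v - f η v‖ :=
            mul_le_mul_of_nonneg_right (hθ1 η) (norm_nonneg _)
        _ ≤ L * ‖ξ - η‖ := by
            rw [one_mul]
            exact hL ξ η v (hξ.trans (le_max_left _ _)) (hη.trans (le_max_left _ _)) hv
        _ ≤ |L| * ‖ξ - η‖ := mul_le_mul_of_nonneg_right (le_abs_self _) (norm_nonneg _)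
    · have h1 : F ξ v - F η v = (θ ξ - θ η) • f ξ v := by
        rw [hF0 η v hη, hθout η hη, sub_zero, sub_zero]
      rw [h1, add_mul]
      exact (hθf ξ η v hξ hv).trans (le_add_of_nonneg_left (by positivity))
  have hFL : ∀ ξ η v, ‖v‖ ≤ ρ → ‖F ξ v - F η v‖ ≤ (|L| + |M|) * ‖ξ - η‖ := by
    intro ξ η v hv
    rcases le_or_gt ‖ξ‖ (R + 2) with hξ | hξ
    · exact hFL' ξ η v hv hξ
    rcases le_or_gt ‖η‖ (R + 2) with hη | hη
    · rw [norm_sub_rev, norm_sub_rev ξ]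
      exact hFL' η ξ v hv hη
    · rw [hF0 ξ v hξ, hF0 η v hη, sub_zero, norm_zero]
      positivity
  have hFM : ∀ ξ v, ‖v‖ ≤ ρ → ‖F ξ v‖ ≤ |M| := by
    intro ξ v hv
    rcases le_or_gt ‖ξ‖ (R + 2) with hξ | hξ
    · rw [hF]
      simp only
      rw [norm_smul, Real.norm_of_nonneg (hθ0 ξ)]
      calc θ ξ * ‖f ξ v‖ ≤ 1 * ‖f ξ v‖ :=
            mul_le_mul_of_nonneg_right (hθ1 ξ) (norm_nonneg _)
        _ ≤ |M| := by
            rw [one_mul]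
            exact (hM ξ v (hξ.trans (le_max_left _ _)) hv).trans (le_abs_self _)
    · rw [hF0 ξ v hξ, norm_zero]; positivity
  have hfc : ∀ v, Continuous fun ξ => f ξ v := by
    intro v
    rw [continuous_iff_continuousAt]
    intro ξ
    obtain ⟨K, hK⟩ := hf.lipschitz (max (‖ξ‖ + 1) ‖v‖)
    refine continuousAt_of_locally_lipschitz zero_lt_one K fun η hη => ?_
    rw [dist_eq_norm, dist_eq_norm]
    rw [dist_eq_norm] at hη
    have : ‖η‖ ≤ ‖ξ‖ + 1 := by
      have := norm_le_norm_add_norm_sub' η ξ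
      linarith
    exact hK _ _ _ (this.trans (le_max_left _ _)) ((by linarith : ‖ξ‖ ≤ ‖ξ‖ + 1).trans
      (le_max_left _ _)) (le_max_right _ _)
  have hθc : Continuous θ := by fun_prop
  have hFm : Measurable (Function.uncurry F) :=
    measurable_uncurry_of_continuous_of_measurable (fun v => hθc.smul (hfc v))
      fun ξ => (hf.measurable ξ).const_smul (θ ξ)
  obtain ⟨ξ, hξc, hξ0, hξ⟩ := exists_isSolutionOn_of_lipschitz hFm hT (hu T).1
    (hur.mono fun s hs hm => (hs hm).trans (le_max_right _ _)) hFL hFM ξ₀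
  have hsol : ∀ t ∈ Icc 0 T, (∀ s ∈ Icc 0 t, ‖ξ s‖ ≤ R + 1) → IsSolutionOn f u ξ t := by
    intro t ht hb
    have heq : EqOn (fun s => F (ξ s) (u s)) (fun s => f (ξ s) (u s)) (Icc 0 t) := fun s hs => by
      simp only [hF, hθin _ (hb s hs), one_smul]
    have h1 := hξ.mono ht.1 ht.2
    refine ⟨h1.1.congr ?_, fun s hs => ?_⟩
    · rw [uIoc_of_le ht.1]
      exact fun s hs => heq (Ioc_subset_Icc_self hs)
    · rw [h1.2 s hs]
      congr 1
      refine intervalIntegral.integral_congr fun τ hτ => ?_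
      rw [uIcc_of_le hs.1] at hτ
      exact heq (Icc_subset_Icc_right hs.2 hτ)
  have hbound : ∀ s ∈ Icc 0 T, ‖ξ s‖ ≤ R + 1 := by
    -- Up to the first time the norm reaches `R + 1`, the truncated solution solves the original
    -- equation, so its norm there is at most `R`.
    by_contra! hex
    obtain ⟨s, hs, hsR⟩ := hex
    have hcl : IsClosed {t ∈ Icc 0 T | R + 1 ≤ ‖ξ t‖} :=
      isClosed_Icc.inter (isClosed_le continuous_const hξc.norm)
    have hcomp : IsCompact {t ∈ Icc 0 T | R + 1 ≤ ‖ξ t‖} :=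
      isCompact_Icc.of_isClosed_subset hcl (sep_subset _ _)
    obtain ⟨t, ⟨ht, htR⟩, hmin⟩ := hcomp.exists_isLeast ⟨s, hs, hsR.le⟩
    have hbelow : ∀ τ ∈ Ico 0 t, ‖ξ τ‖ ≤ R + 1 := by
      intro τ hτ
      by_contra! hcon
      exact absurd (hmin ⟨⟨hτ.1, hτ.2.le.trans ht.2⟩, hcon.le⟩) (not_le.2 hτ.2)
    have hlt : ∀ τ ∈ Icc 0 t, ‖ξ τ‖ ≤ R + 1 := by
      -- If the first hitting time is `0`, the half-open interval before it is empty, so the bound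
      -- at the initial point is taken from the degenerate solution on `[0, 0]`.
      have hR0 := hR ξ 0 ⟨le_rfl, hT⟩ hξ0 ⟨by simp, fun t ht => by
        have : t = 0 := le_antisymm ht.2 ht.1
        simp [this]⟩
      rcases ht.1.eq_or_lt with h | h
      · rw [← h]
        intro τ hτ
        rw [le_antisymm hτ.2 hτ.1]
        linarith
      · have := closure_minimal (s := Ico 0 t) (t := {τ | ‖ξ τ‖ ≤ R + 1}) hbelow
          (isClosed_le hξc.norm continuous_const)
        rwa [closure_Ico h.ne] at this
    have := hR ξ t ht hξ0 (hsol t ht hlt)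
    linarith
  exact ⟨ξ, hξ0, hsol T ⟨hT, le_rfl⟩ hbound⟩

/-- A priori bounds on bounded intervals give a solution on `[0, ∞)`. -/
theorem IsCaratheodoryField.exists_global_solution {f : X → U → X} (hf : IsCaratheodoryField f)
    {u : ℝ → U} (hu : IsAdmissibleInput u) {ξ₀ : X}
    (hR : ∀ T : ℝ, 0 ≤ T → ∃ R : ℝ, ∀ (ξ : ℝ → X) (t : ℝ), t ∈ Icc 0 T → ξ 0 = ξ₀ →
      IsSolutionOn f u ξ t → ‖ξ t‖ ≤ R) :
    ∃ ξ : ℝ → X, ξ 0 = ξ₀ ∧ ∀ T, 0 ≤ T → IsSolutionOn f u ξ T := by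
  have hex : ∀ k : ℕ, ∃ ξ : ℝ → X, ξ 0 = ξ₀ ∧ IsSolutionOn f u ξ k := fun k => by
    obtain ⟨R, hR⟩ := hR k k.cast_nonneg
    exact hf.exists_isSolutionOn hu k.cast_nonneg hR
  choose ζ hζ0 hζ using hex
  -- By uniqueness the solutions on the intervals `[0, k]` agree where they overlap, so they can be
  -- glued.
  refine ⟨fun t => ζ ⌈t⌉₊ t, by simp [hζ0], fun T hT => ?_⟩
  refine ((hζ ⌈T⌉₊).mono hT (Nat.le_ceil T)).congr hT fun t ht => ?_
  have hle : (⌈t⌉₊ : ℝ) ≤ ⌈T⌉₊ := by exact_mod_cast Nat.ceil_mono ht.2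
  exact hf.eqOn_of_isSolutionOn hu (Nat.cast_nonneg _) (hζ _)
    ((hζ ⌈T⌉₊).mono (Nat.cast_nonneg _) hle) (by rw [hζ0, hζ0]) ⟨ht.1, Nat.le_ceil t⟩

end Existence

/-! ### Growth of the slow dynamics on the steady-state manifold -/

/-- An autonomous field with a coercive Lyapunov function is forward complete. -/
theorem exists_flow_of_lyapunov {E : Type*} [NormedAddCommGroup E] [NormedSpace ℝ E]
    [FiniteDimensional ℝ E] {h : E → E} (hh : LocallyLipschitz h) {V : E → ℝ}
    (hV : ContDiff ℝ 1 V) {a : ℝ} (ha : 0 < a) (hlow : ∀ x, a * ‖x‖ ^ 2 ≤ V x)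
    (hdec : ∀ x, fderiv ℝ V x (h x) ≤ 0) (x₀ : E) :
    ∃ y : ℝ → E, y 0 = x₀ ∧ (∀ T, 0 ≤ T → IsSolutionOn (fun ξ (_ : ℝ) => h ξ) 0 y T) ∧
      ∀ t, 0 ≤ t → V (y t) ≤ V x₀ := by
  have : ProperSpace E := FiniteDimensional.proper ℝ E
  have : CompleteSpace E := FiniteDimensional.complete ℝ E
  borelize E
  have hf : IsCaratheodoryField (fun ξ (_ : ℝ) => h ξ) := by
    refine ⟨fun R => ?_, fun ξ => measurable_const, fun R => ?_⟩
    · obtain ⟨K, hK⟩ := (hh.locallyLipschitzOn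
        (s := Metric.closedBall 0 R)).exists_lipschitzOnWith_of_compact (isCompact_closedBall _ _)
      refine ⟨K, fun ξ η _ hξ hη _ => ?_⟩
      rw [← dist_eq_norm, ← dist_eq_norm]
      exact hK.dist_le_mul _ (by simpa using hξ) _ (by simpa using hη)
    · obtain ⟨M, hM⟩ := (isCompact_closedBall (0 : E) R).exists_bound_of_continuousOn
        hh.continuous.continuousOn
      exact ⟨M, fun ξ _ hξ _ => hM ξ (by simpa using hξ)⟩
  have hu : IsAdmissibleInput (0 : ℝ → ℝ) := fun T => MemLp.zero
  have hmono : ∀ (ξ : ℝ → E) (t : ℝ), 0 ≤ t → IsSolutionOn (fun ξ (_ : ℝ) => h ξ) 0 ξ t →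
      V (ξ t) ≤ V (ξ 0) := by
    intro ξ t ht hξ
    obtain ⟨hac, hd⟩ := hξ.ae_deriv_max ht hV hV
    have h1 := hac.le_of_deriv_nonpos ht (by
      filter_upwards [hd] with s hs hm
      rw [(hs hm).1 le_rfl]
      exact hdec _)
    simpa using h1
  have hbd : ∀ (ξ : ℝ → E) (t : ℝ), 0 ≤ t → ξ 0 = x₀ →
      IsSolutionOn (fun ξ (_ : ℝ) => h ξ) 0 ξ t → ‖ξ t‖ ≤ √(V x₀ / a) := by
    intro ξ t ht h0 hξ
    refine Real.le_sqrt_of_sq_le ?_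
    rw [le_div_iff₀ ha, mul_comm, ← h0]
    exact (hlow _).trans (hmono ξ t ht hξ)
  obtain ⟨y, hy0, hy⟩ := hf.exists_global_solution hu (ξ₀ := x₀)
    fun T _ => ⟨_, fun ξ t ht h0 hξ => hbd ξ t ht.1 h0 hξ⟩
  exact ⟨y, hy0, hy, fun t ht => hy0 ▸ hmono y t ht (hy t ht)⟩

/-- If the length `∫ ‖g‖` controls the variation of `g`, then a curve with velocity `g` moves away
from its initial position at a rate proportional to `‖g 0‖`, up to a multiple of `u`. -/
theorem norm_velocity_le_of_variation_le {E : Type*} [NormedAddCommGroup E] [NormedSpace ℝ E]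
    [CompleteSpace E] {g : ℝ → E} {C u δ : ℝ} (hC : 0 < C) (hu : 0 ≤ u)
    (hint : ∀ T, 0 ≤ T → IntervalIntegrable g volume 0 T)
    (hvar : ∀ t, 0 ≤ t → ‖g t - g 0‖ ≤ C * ((∫ s in (0 : ℝ)..t, ‖g s‖) + u))
    (hdist : ∀ t, 0 ≤ t → ‖∫ s in (0 : ℝ)..t, g s‖ ≤ δ * u) :
    ‖g 0‖ ≤ (2 * C * δ / Real.log (3 / 2) + 3 * C) * u := by
  -- With `exp (C T) = 3/2`, Grönwall bounds the length on `[0, T]` by `(v/C + u)/2`. The velocity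
  -- then changes by at most `v/2 + 3Cu/2`, which leaves half of `v` to produce displacement.
  set T := Real.log (3 / 2) / C with hTdef
  have hlog : 0 < Real.log (3 / 2) := Real.log_pos (by norm_num)
  have hT : 0 < T := div_pos hlog hC
  set v := ‖g 0‖ with hv
  have hv0 : 0 ≤ v := norm_nonneg _
  set ℓ : ℝ → ℝ := fun t => ∫ s in (0 : ℝ)..t, ‖g s‖ with hℓ
  have hgrow : ∀ t ∈ Icc 0 T, ℓ t ≤ (v / C + u) / 2 := by
    intro t ht
    have hac1 : AbsolutelyContinuousOnInterval ℓ 0 t :=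
      (hint t ht.1).norm.absolutelyContinuousOnInterval_intervalIntegral (by simp)
    have hac2 : AbsolutelyContinuousOnInterval (fun _ : ℝ => v / C + u) 0 t :=
      contDiffOn_const.absolutelyContinuousOnInterval
    have hac3 : AbsolutelyContinuousOnInterval (fun s : ℝ => Real.exp (-(C * s))) 0 t :=
      ContDiffOn.absolutelyContinuousOnInterval (by fun_prop)
    have key := (hac3.mul (hac1.add hac2)).le_of_deriv_nonpos ht.1 (by
      filter_upwards [(hint t ht.1).norm.ae_hasDerivAt_integral] with s hs hm
      have hsI : s ∈ uIcc 0 t := by rw [uIcc_of_le ht.1]; exact Ioo_subset_Icc_self hm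
      have hd1 : HasDerivAt ℓ ‖g s‖ s := hs hsI 0 (by simp)
      have hd2 : HasDerivAt (fun s : ℝ => Real.exp (-(C * s))) (Real.exp (-(C * s)) * (-(C * 1))) s :=
        (((hasDerivAt_id s).const_mul C).neg).exp
      have hd3 := (hd2.mul (hd1.add (hasDerivAt_const s (v / C + u)))).deriv
      rw [hd3]
      have hgs : ‖g s‖ ≤ v + C * (ℓ s + u) := by
        have h1 := norm_le_norm_add_norm_sub' (g s) (g 0)
        have h2 := hvar s hm.1.le
        linarith
      have hE := Real.exp_pos (-(C * s))
      have h3 : C * (v / C + u) = v + C * u := by field_simp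
      have h4 : Real.exp (-(C * s)) * (-(C * 1)) * (ℓ + fun _ : ℝ => v / C + u) s
          + Real.exp (-(C * s)) * (‖g s‖ + 0)
          = Real.exp (-(C * s)) * (‖g s‖ - C * ℓ s - C * (v / C + u)) := by
        simp only [Pi.add_apply]; ring
      rw [h4, h3]
      exact mul_nonpos_of_nonneg_of_nonpos hE.le (by linarith))
    have hℓ0 : ℓ 0 = 0 := by simp [hℓ]
    simp only [Pi.mul_apply, Pi.add_apply, hℓ0, mul_zero, neg_zero, Real.exp_zero, one_mul,
      zero_add] at key
    have hE : Real.exp (C * t) ≤ 3 / 2 := by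
      rw [← Real.exp_log (show (0 : ℝ) < 3 / 2 by norm_num), Real.exp_le_exp]
      calc C * t ≤ C * T := mul_le_mul_of_nonneg_left ht.2 hC.le
        _ = _ := by rw [hTdef]; field_simp
    have h5 : ℓ t + (v / C + u) ≤ 3 / 2 * (v / C + u) := by
      have hB : 0 ≤ v / C + u := by positivity
      calc ℓ t + (v / C + u)
          = Real.exp (C * t) * (Real.exp (-(C * t)) * (ℓ t + (v / C + u))) := by
            rw [← mul_assoc, ← Real.exp_add]; simp
        _ ≤ Real.exp (C * t) * (v / C + u) := mul_le_mul_of_nonneg_left key (Real.exp_pos _).le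
        _ ≤ _ := mul_le_mul_of_nonneg_right hE hB
    linarith
  have h1 : (∫ s in (0 : ℝ)..T, (g 0 - g s)) = T • g 0 - ∫ s in (0 : ℝ)..T, g s := by
    rw [intervalIntegral.integral_sub intervalIntegrable_const (hint T hT.le),
      intervalIntegral.integral_const, sub_zero]
  have h2 : ‖∫ s in (0 : ℝ)..T, (g 0 - g s)‖ ≤ C * ((v / C + u) / 2 + u) * |T - 0| := by
    refine intervalIntegral.norm_integral_le_of_norm_le_const fun s hs => ?_
    rw [uIoc_of_le hT.le] at hs
    rw [norm_sub_rev]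
    refine (hvar s hs.1.le).trans (mul_le_mul_of_nonneg_left ?_ hC.le)
    have := hgrow s ⟨hs.1.le, hs.2⟩
    simp only [hℓ] at this
    linarith
  rw [h1, sub_zero, abs_of_pos hT] at h2
  have h3 : T * v ≤ δ * u + C * ((v / C + u) / 2 + u) * T := by
    have h4 := norm_le_norm_add_norm_sub' (T • g 0) (∫ s in (0 : ℝ)..T, g s)
    rw [norm_smul, Real.norm_of_nonneg hT.le] at h4
    have h5 := hdist T hT.le
    linarith
  have h4 : C * ((v / C + u) / 2 + u) = v / 2 + 3 / 2 * (C * u) := by field_simp; ring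
  rw [h4] at h3
  have h5 : v * T ≤ 2 * (δ * u) + 3 * (C * u) * T := by linarith
  have h6 : v ≤ 2 * (δ * u) / T + 3 * (C * u) := by
    rw [← sub_le_iff_le_add, le_div_iff₀ hT]
    linarith
  refine h6.trans (le_of_eq ?_)
  rw [hTdef]
  field_simp

/-- The flow is used instead of a segment because `V_s` must stay below its initial value, both to
confine the curve and to control the second term of the gradient bound. The quadratic lower bound on
`V_f` converts growth of `V_f (φ x₀)` into variation of `φ`. -/
theorem exists_slow_field_bound {E F : Type*} [NormedAddCommGroup E] [NormedSpace ℝ E]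
    [FiniteDimensional ℝ E] [NormedAddCommGroup F] [NormedSpace ℝ F]
    {h : E → F → E} {φ : E → F} {Vs : E → ℝ} {Vf : F → E → ℝ} {L a b a₁ a₂ : ℝ}
    (hφ : LocallyLipschitz φ)
    (hL0 : 0 ≤ L) (hL : ∀ x x' z z', ‖h x z - h x' z'‖ ≤ L * (‖x - x'‖ + ‖z - z'‖))
    (hVs : ContDiff ℝ 1 Vs) (hVf : ∀ z, ContDiff ℝ 1 (Vf z)) (ha : 0 < a) (hb : 0 < b)
    (ha₁ : 0 ≤ a₁) (ha₂ : 0 ≤ a₂)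
    (hVslow : ∀ x, a * ‖x‖ ^ 2 ≤ Vs x) (hVflow : ∀ z x, b * ‖z - φ x‖ ^ 2 ≤ Vf z x)
    (hVf0 : ∀ x, Vf (φ x) x = 0)
    (hcross : ∀ z x, ‖fderiv ℝ (Vf z) x‖ ≤ a₁ * √(Vf z x) + a₂ * √(Vs x))
    (hdec : ∀ x, fderiv ℝ Vs x (h x (φ x)) ≤ 0) :
    ∃ C, 0 ≤ C ∧ ∀ x, ‖h x (φ x)‖ ≤ C * √(Vs x) := by
  have : CompleteSpace E := FiniteDimensional.complete ℝ E
  have hlip : LocallyLipschitz fun x => h x (φ x) := by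
    intro x
    obtain ⟨K, s, hs, hK⟩ := hφ x
    refine ⟨Real.toNNReal (L * (1 + K)), s, hs, LipschitzOnWith.of_dist_le_mul fun y hy z hz => ?_⟩
    rw [Real.coe_toNNReal _ (by positivity), dist_eq_norm]
    have h1 := hK.dist_le_mul y hy z hz
    rw [dist_eq_norm] at h1
    calc _ ≤ L * (‖y - z‖ + ‖φ y - φ z‖) := hL _ _ _ _
      _ ≤ L * (dist y z + K * dist y z) := by rw [dist_eq_norm] at *; gcongr
      _ = _ := by ring
  have hVf_nonneg : ∀ z x, 0 ≤ Vf z x := fun z x => le_trans (by positivity) (hVflow z x)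
  have hVs_nonneg : ∀ x, 0 ≤ Vs x := fun x => le_trans (by positivity) (hVslow x)
  set c := (a₁ + a₂) / 2 with hc
  have hc0 : 0 ≤ c := by positivity
  set C := L * (1 + c / √b + 1 / √b) + 1 with hC
  have hsb : 0 < √b := Real.sqrt_pos.2 hb
  have hsa : 0 < √a := Real.sqrt_pos.2 ha
  have hCpos : 0 < C := by positivity
  have hlog : 0 < Real.log (3 / 2) := Real.log_pos (by norm_num)
  refine ⟨2 * C * (2 / √a) / Real.log (3 / 2) + 3 * C, by positivity, fun x₀ => ?_⟩
  have hnorm : ∀ x, √a * ‖x‖ ≤ √(Vs x) := fun x => by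
    refine Real.le_sqrt_of_sq_le ?_
    rw [mul_pow, Real.sq_sqrt ha.le]
    exact hVslow x
  obtain ⟨y, hy0, hy, hyV⟩ := exists_flow_of_lyapunov hlip hVs ha hVslow hdec x₀
  set u := √(Vs x₀) with hu
  -- If `V_s(x₀) = 0`, the flow is confined to the origin, and the integral equation forces the
  -- field to vanish there. Otherwise `u > 0` keeps `q` positive, so that `√q` is differentiable.
  rcases (Real.sqrt_nonneg (Vs x₀)).eq_or_lt with hu0 | hupos
  · rw [← hu] at hu0
    have hVsx : ∀ t, 0 ≤ t → y t = 0 := fun t ht => by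
      have h1 := hyV t ht
      have h2 := Real.sqrt_le_sqrt h1
      rw [← hu, ← hu0] at h2
      have h3 := (hnorm (y t)).trans h2
      have h4 : ‖y t‖ ≤ 0 := by
        by_contra! h5
        exact absurd (mul_pos hsa h5) (not_lt.2 h3)
      exact norm_le_zero_iff.1 h4
    have h1 := (hy 1 zero_le_one).2 1 ⟨zero_le_one, le_rfl⟩
    rw [hVsx 1 zero_le_one, hVsx 0 le_rfl, zero_add] at h1
    have h2 : ∫ s in (0 : ℝ)..1, h (y s) (φ (y s)) = ∫ s in (0 : ℝ)..1, h 0 (φ 0) := by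
      refine intervalIntegral.integral_congr fun s hs => ?_
      rw [uIcc_of_le zero_le_one] at hs
      simp only [hVsx s hs.1]
    have hx₀ : x₀ = 0 := by rw [← hy0, hVsx 0 le_rfl]
    simp only at h1
    rw [h2] at h1
    simp only [intervalIntegral.integral_const, sub_zero, one_smul] at h1
    rw [hx₀, ← h1, norm_zero, ← hu0, mul_zero]
  rw [← hu] at hupos
  have hu2 : u ^ 2 = Vs x₀ := Real.sq_sqrt (hVs_nonneg x₀)
  -- Adding `u²` lets `√q` dominate both `√V_f` and `√V_s` along the flow. Hence the gradient of
  -- `√q` has norm at most `c = (a₁ + a₂)/2`.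
  set q : E → ℝ := fun x => Vf (φ x₀) x + u ^ 2 with hq
  have hqpos : ∀ x, 0 < q x := fun x => by have := hVf_nonneg (φ x₀) x; positivity
  have hqc : ContDiff ℝ 1 q := (hVf (φ x₀)).add contDiff_const
  have hDc : ContDiff ℝ 1 fun x => √(q x) := hqc.sqrt fun x => (hqpos x).ne'
  have hint : ∀ T, 0 ≤ T → IntervalIntegrable (fun s => h (y s) (φ (y s))) volume 0 T :=
    fun T hT => (hy T hT).1
  set ℓ : ℝ → ℝ := fun t => ∫ s in (0 : ℝ)..t, ‖h (y s) (φ (y s))‖ with hℓ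
  have hdisp : ∀ t, 0 ≤ t → y t - x₀ = ∫ s in (0 : ℝ)..t, h (y s) (φ (y s)) := by
    intro t ht
    rw [(hy t ht).2 t ⟨ht, le_rfl⟩, hy0, add_sub_cancel_left]
  have hgrow : ∀ t, 0 ≤ t → √(q (y t)) ≤ u + c * ℓ t := by
    intro t ht
    obtain ⟨hac, hd⟩ := (hy t ht).ae_deriv_max ht hDc hDc
    simp only [max_self] at hac hd
    have hacℓ : AbsolutelyContinuousOnInterval ℓ 0 t :=
      (hint t ht).norm.absolutelyContinuousOnInterval_intervalIntegral (by simp)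
    have key := (hac.sub (hacℓ.const_mul c)).le_of_deriv_nonpos ht (by
      filter_upwards [hd, hac.ae_differentiableAt, (hint t ht).norm.ae_hasDerivAt_integral]
        with s hs hsd hsℓ hm
      have hsI : s ∈ uIcc 0 t := by rw [uIcc_of_le ht]; exact Ioo_subset_Icc_self hm
      have hd1 : HasDerivAt ℓ ‖h (y s) (φ (y s))‖ s := hsℓ hsI 0 (by simp)
      have hd2 := ((hsd hsI).hasDerivAt.sub (hd1.const_mul c)).deriv
      rw [hd2, (hs hm).1 le_rfl]
      have hqs := hqpos (y s)
      have hf : HasFDerivAt (fun x => √(q x)) ((1 / (2 * √(q (y s)))) • fderiv ℝ q (y s)) (y s) :=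
        ((hqc.differentiable (by simp)) (y s)).hasFDerivAt.sqrt hqs.ne'
      have hfq : fderiv ℝ q (y s) = fderiv ℝ (Vf (φ x₀)) (y s) := by
        rw [hq]; exact fderiv_add_const _
      rw [hf.fderiv, hfq, sub_nonpos]
      have hsq : 0 < √(q (y s)) := Real.sqrt_pos.2 hqs
      have h1 : √(Vf (φ x₀) (y s)) ≤ √(q (y s)) :=
        Real.sqrt_le_sqrt (le_add_of_nonneg_right (sq_nonneg u))
      have h2 : √(Vs (y s)) ≤ √(q (y s)) := by
        refine Real.sqrt_le_sqrt ((hyV s hm.1.le).trans ?_)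
        rw [← hu2]
        exact le_add_of_nonneg_left (hVf_nonneg _ _)
      have h3 : ‖fderiv ℝ (Vf (φ x₀)) (y s)‖ ≤ 2 * c * √(q (y s)) := by
        refine (hcross _ _).trans ?_
        calc _ ≤ a₁ * √(q (y s)) + a₂ * √(q (y s)) := by gcongr
          _ = _ := by rw [hc]; ring
      rw [smul_apply, smul_eq_mul, one_div, inv_mul_le_iff₀ (by positivity)]
      calc _ ≤ ‖fderiv ℝ (Vf (φ x₀)) (y s) (h (y s) (φ (y s)))‖ := Real.le_norm_self _
        _ ≤ ‖fderiv ℝ (Vf (φ x₀)) (y s)‖ * ‖h (y s) (φ (y s))‖ :=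
          ContinuousLinearMap.le_opNorm _ _
        _ ≤ 2 * c * √(q (y s)) * ‖h (y s) (φ (y s))‖ := by gcongr
        _ = _ := by ring)
    have hq0 : √(q x₀) = u := by
      simp only [hq, hVf0, zero_add]
      exact Real.sqrt_sq hupos.le
    have hℓ0 : ℓ 0 = 0 := by simp [hℓ]
    simp only [Pi.sub_apply, hy0, hq0, hℓ0, mul_zero, sub_zero] at key
    linarith
  have hvar : ∀ t, 0 ≤ t →
      ‖h (y t) (φ (y t)) - h (y 0) (φ (y 0))‖ ≤ C * (ℓ t + u) := by
    intro t ht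
    have hℓt : 0 ≤ ℓ t := intervalIntegral.integral_nonneg ht fun s _ => norm_nonneg _
    have h1 : ‖y t - y 0‖ ≤ ℓ t := by
      rw [hy0, hdisp t ht]
      exact intervalIntegral.norm_integral_le_integral_norm ht
    have h2 : ‖φ (y t) - φ (y 0)‖ ≤ (u + c * ℓ t) / √b := by
      rw [le_div_iff₀ hsb, hy0]
      refine le_trans ?_ (hgrow t ht)
      refine Real.le_sqrt_of_sq_le ?_
      rw [mul_pow, Real.sq_sqrt hb.le, mul_comm, norm_sub_rev]
      exact (hVflow _ _).trans (le_add_of_nonneg_right (sq_nonneg u))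
    calc _ ≤ L * (‖y t - y 0‖ + ‖φ (y t) - φ (y 0)‖) := hL _ _ _ _
      _ ≤ L * (ℓ t + (u + c * ℓ t) / √b) := by gcongr
      _ ≤ L * ((1 + c / √b + 1 / √b) * (ℓ t + u)) := by
        refine mul_le_mul_of_nonneg_left ?_ hL0
        have e1 : (1 + c / √b + 1 / √b) * (ℓ t + u) = ℓ t + (u + c * ℓ t) / √b
          + (u + c / √b * u + 1 / √b * ℓ t) := by ring
        rw [e1]
        refine le_add_of_nonneg_right ?_
        positivity
      _ ≤ C * (ℓ t + u) := by
        rw [hC]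
        have : 0 ≤ ℓ t + u := by positivity
        linarith
  have hdist : ∀ t, 0 ≤ t → ‖∫ s in (0 : ℝ)..t, h (y s) (φ (y s))‖ ≤ 2 / √a * u := by
    intro t ht
    rw [← hdisp t ht]
    have h1 : ∀ x, Vs x ≤ Vs x₀ → ‖x‖ ≤ u / √a := fun x hx => by
      rw [le_div_iff₀ hsa, mul_comm]
      exact (hnorm x).trans (Real.sqrt_le_sqrt hx)
    have h2 := h1 _ (hyV t ht)
    have h3 := h1 x₀ le_rfl
    have h4 := norm_sub_le (y t) x₀
    have h5 : 2 / √a * u = u / √a + u / √a := by ring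
    linarith
  have := norm_velocity_le_of_variation_le (g := fun s => h (y s) (φ (y s))) hCpos hupos.le hint
    hvar hdist
  simpa only [hy0] using this

/-! ### Class `𝒦` functions -/

theorem IsK.nonneg {α : ℝ → ℝ} (h : IsK α) {r : ℝ} (hr : 0 ≤ r) : 0 ≤ α r :=
  h.2.2 ▸ h.2.1.monotoneOn (mem_Ici.2 le_rfl) hr hr

theorem IsK.mono {α : ℝ → ℝ} (h : IsK α) {r s : ℝ} (hr : 0 ≤ r) (hrs : r ≤ s) : α r ≤ α s :=
  h.2.1.monotoneOn hr (hr.trans hrs) hrs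

theorem IsK.comp {α β : ℝ → ℝ} (hα : IsK α) (hβ : IsK β) : IsK fun r => α (β r) :=
  ⟨hα.1.comp hβ.1 fun _ hr => hβ.nonneg hr,
    fun _ ha _ hb hab => hα.2.1 (hβ.nonneg ha) (hβ.nonneg hb) (hβ.2.1 ha hb hab),
    by simp [hβ.2.2, hα.2.2]⟩

theorem IsK.add {α β : ℝ → ℝ} (hα : IsK α) (hβ : IsK β) : IsK fun r => α r + β r :=
  ⟨hα.1.add hβ.1, fun _ ha _ hb hab => add_lt_add (hα.2.1 ha hb hab) (hβ.2.1 ha hb hab),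
    by simp [hα.2.2, hβ.2.2]⟩

theorem IsK.const_mul {α : ℝ → ℝ} (hα : IsK α) {c : ℝ} (hc : 0 < c) : IsK fun r => c * α r :=
  ⟨continuousOn_const.mul hα.1, fun _ ha _ hb hab => mul_lt_mul_of_pos_left (hα.2.1 ha hb hab) hc,
    by simp [hα.2.2]⟩

theorem isK_sqrt_div {a : ℝ} (ha : 0 < a) : IsK fun r => √(r / a) :=
  ⟨(Continuous.sqrt (continuous_id.div_const a)).continuousOn,
    fun r hr s _ hrs => Real.sqrt_lt_sqrt (div_nonneg hr ha.le) (div_lt_div_of_pos_right hrs ha),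
    by simp⟩

theorem isK_sq : IsK fun r => r ^ 2 :=
  ⟨by fun_prop, fun r hr s _ hrs => pow_lt_pow_left₀ hrs hr two_ne_zero, by simp⟩

/-- A continuous function vanishing at `e` is dominated by a class `𝒦` function of the distance
to `e`. -/
theorem exists_isK_bound {E : Type*} [NormedAddCommGroup E] [NormedSpace ℝ E]
    [FiniteDimensional ℝ E] {W : E → ℝ} (hW : Continuous W) {e : E} (he : W e = 0) :
    ∃ ω : ℝ → ℝ, IsK ω ∧ ∀ x, W x ≤ ω ‖x - e‖ := by
  have : ProperSpace E := FiniteDimensional.proper ℝ E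
  -- The balls around `e` are parametrized by the fixed unit ball, so that the supremum of `W` is
  -- continuous in the radius; adding `r` later makes it strictly increasing.
  set S : ℝ → Set ℝ := fun r => (fun y => W (e + r • y)) '' Metric.closedBall 0 1 with hS
  have hcomp : IsCompact (Metric.closedBall (0 : E) 1) := isCompact_closedBall _ _
  have hbdd : ∀ r, BddAbove (S r) := fun r => (hcomp.image (by fun_prop)).bddAbove
  have hne : (Metric.closedBall (0 : E) 1).Nonempty := ⟨0, by simp⟩
  have hc : Continuous fun r => sSup (S r) :=
    hcomp.continuous_sSup (f := fun (r : ℝ) (y : E) => W (e + r • y)) (by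
      change Continuous fun p : ℝ × E => W (e + p.1 • p.2)
      fun_prop)
  have hmono : ∀ r s, 0 ≤ r → r < s → sSup (S r) ≤ sSup (S s) := by
    intro r s hr hrs
    refine csSup_le_csSup (hbdd s) (hne.image _) ?_
    have hs : 0 < s := hr.trans_lt hrs
    rintro _ ⟨y, hy, rfl⟩
    refine ⟨(r / s) • y, ?_, ?_⟩
    · rw [mem_closedBall_zero_iff] at hy ⊢
      rw [norm_smul, Real.norm_of_nonneg (by positivity)]
      exact mul_le_one₀ ((div_le_one hs).2 hrs.le) (norm_nonneg _) hy
    · simp only [smul_smul, mul_div_cancel₀ _ hs.ne']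
  refine ⟨fun r => sSup (S r) + r, ⟨(hc.add continuous_id).continuousOn, ?_, ?_⟩, fun x => ?_⟩
  · exact fun r hr s _ hrs => add_lt_add_of_le_of_lt (hmono r s hr hrs) hrs
  · have : S 0 = {0} := by
      simp only [hS, zero_smul, add_zero, he]
      exact hne.image_const 0
    simp [this]
  · refine le_trans (le_csSup (hbdd _) ⟨(‖x - e‖)⁻¹ • (x - e), ?_, ?_⟩)
      (le_add_of_nonneg_right (norm_nonneg _))
    · rw [mem_closedBall_zero_iff, norm_smul, norm_inv, norm_norm]
      exact inv_mul_le_one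
    · rcases eq_or_ne x e with rfl | hx
      · simp
      · simp only [smul_smul]
        rw [mul_inv_cancel₀ (norm_ne_zero_iff.2 (sub_ne_zero.2 hx)), one_smul, add_sub_cancel]

/-! ### Input-to-state stability from a maximum of two Lyapunov functions -/

/-- Whenever the maximum exceeds `σ` of the essential supremum of the input, whichever function
attains it decreases at rate `α`, so the comparison lemma applies with level `c = σ(‖u‖_∞)`.
Smoothness of the maximum itself is not needed. -/
theorem isISS_of_lyapunov_max {X U : Type*} [NormedAddCommGroup X] [NormedSpace ℝ X]
    [CompleteSpace X] [SecondCountableTopology X] [MeasurableSpace X] [BorelSpace X]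
    [NormedAddCommGroup U] [MeasurableSpace U] [BorelSpace U] {f : X → U → X}
    (hf : IsCaratheodoryField f) {ξe : X} {V W : X → ℝ} (hV : ContDiff ℝ 1 V)
    (hW : ContDiff ℝ 1 W) (hV0 : ∀ ξ, 0 ≤ V ξ) {α σ ψ₁ ψ₂ : ℝ → ℝ} (hα : IsPD α) (hσ : IsK σ)
    (hψ₁ : IsK ψ₁) (hψ₂ : IsK ψ₂) (hlow : ∀ ξ, ‖ξ - ξe‖ ≤ ψ₁ (max (V ξ) (W ξ)))
    (hup : ∀ ξ, max (V ξ) (W ξ) ≤ ψ₂ ‖ξ - ξe‖)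
    (hVdec : ∀ ξ v, σ ‖v‖ ≤ V ξ → W ξ ≤ V ξ → fderiv ℝ V ξ (f ξ v) ≤ -α (V ξ))
    (hWdec : ∀ ξ v, σ ‖v‖ ≤ W ξ → V ξ ≤ W ξ → fderiv ℝ W ξ (f ξ v) ≤ -α (W ξ)) :
    IsISS f ξe := by
  obtain ⟨β, ⟨hβc, hβK, hβL⟩, hβ⟩ := exists_isKL_decay hα
  have hβ0 : ∀ s t, 0 ≤ s → 0 ≤ t → 0 ≤ β s t := fun s t hs ht => (hβK t ht).nonneg hs
  have hKL : IsKL fun s t => ψ₁ (β (ψ₂ s) t) := by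
    refine ⟨?_, fun t ht => hψ₁.comp ((hβK t ht).comp hψ₂), fun s hs => ⟨?_, ?_⟩⟩
    · refine hψ₁.1.comp (hβc.comp (f := fun p : ℝ × ℝ => (ψ₂ p.1, p.2)) ?_ ?_) ?_
      · exact (hψ₂.1.comp continuousOn_fst fun p hp => hp.1).prodMk continuousOn_snd
      · exact fun p hp => ⟨hψ₂.nonneg hp.1, hp.2⟩
      · exact fun p hp => hβ0 _ _ (hψ₂.nonneg hp.1) hp.2
    · have hs' : 0 < ψ₂ s := hψ₂.2.2 ▸ hψ₂.2.1 (mem_Ici.2 le_rfl) hs.le hs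
      exact fun a ha b hb hab => hψ₁.mono (hβ0 _ _ hs'.le hb) ((hβL _ hs').1 ha hb hab)
    · have hs' : 0 < ψ₂ s := hψ₂.2.2 ▸ hψ₂.2.1 (mem_Ici.2 le_rfl) hs.le hs
      have h1 : Tendsto ψ₁ (𝓝[Ici 0] 0) (𝓝 0) := by
        simpa [ContinuousWithinAt, hψ₁.2.2] using hψ₁.1 0 (mem_Ici.2 le_rfl)
      refine h1.comp (tendsto_nhdsWithin_iff.2 ⟨(hβL _ hs').2, ?_⟩)
      filter_upwards [eventually_ge_atTop 0] with t ht using hβ0 _ _ hs'.le ht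
  have hest : ∀ u : ℝ → U, IsAdmissibleInput u → ∀ (ξ : ℝ → X) (t : ℝ), 0 ≤ t →
      IsSolutionOn f u ξ t → ‖ξ t - ξe‖ ≤ max (ψ₁ (β (ψ₂ ‖ξ 0 - ξe‖) t))
        (ψ₁ (σ (eLpNorm u ⊤ (volume.restrict (Icc 0 t))).toReal)) := by
    intro u hu ξ t ht hξ
    obtain ⟨hr0, hur⟩ := hu.exists_bound t
    set r := (eLpNorm u ⊤ (volume.restrict (Icc 0 t))).toReal
    obtain ⟨hac, hd⟩ := hξ.ae_deriv_max ht hV hW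
    have h1 := hβ _ t (σ r) ht (hσ.nonneg hr0) hac (by
      filter_upwards [hd, hur] with s hs hus hm hlt
      have hus' : σ ‖u s‖ ≤ σ r := hσ.mono (norm_nonneg _) (hus (Ioo_subset_Icc_self hm))
      rcases le_total (W (ξ s)) (V (ξ s)) with hle | hle
      · rw [(hs hm).1 hle, max_eq_left hle]
        rw [max_eq_left hle] at hlt
        exact hVdec _ _ (hus'.trans hlt.le) hle
      · rw [(hs hm).2 hle, max_eq_right hle]
        rw [max_eq_right hle] at hlt
        exact hWdec _ _ (hus'.trans hlt.le) hle)
    have hm0 : ∀ ξ, 0 ≤ max (V ξ) (W ξ) := fun ξ => (hV0 ξ).trans (le_max_left _ _)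
    refine (hlow _).trans ((hψ₁.mono (hm0 _) h1).trans ?_)
    have hb : β (max (V (ξ 0)) (W (ξ 0))) t ≤ β (ψ₂ ‖ξ 0 - ξe‖) t :=
      (hβK t ht).mono (hm0 _) (hup _)
    rcases le_total (β (max (V (ξ 0)) (W (ξ 0))) t) (σ r) with h | h
    · rw [max_eq_right h]; exact le_max_right _ _
    · rw [max_eq_left h]
      exact (hψ₁.mono (hβ0 _ _ (hm0 _) ht) hb).trans (le_max_left _ _)
  refine ⟨_, _, hKL, hψ₁.comp hσ, fun u hu => ⟨fun ξ₀ => ?_, hest u hu⟩⟩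
  -- The stability estimate, made uniform on `[0, T]` by monotonicity of `β` in time and of the
  -- essential supremum in the interval, is the a priori bound for existence.
  refine hf.exists_global_solution hu fun T hT =>
    ⟨‖ξe‖ + (ψ₁ (β (ψ₂ ‖ξ₀ - ξe‖) 0) +
      ψ₁ (σ (eLpNorm u ⊤ (volume.restrict (Icc 0 T))).toReal)), fun ξ t ht h0 hξ => ?_⟩
  have h1 := hest u hu ξ t ht.1 hξ
  rw [h0] at h1
  have hs0 : 0 ≤ ψ₂ ‖ξ₀ - ξe‖ := hψ₂.nonneg (norm_nonneg _)
  have hβt : β (ψ₂ ‖ξ₀ - ξe‖) t ≤ β (ψ₂ ‖ξ₀ - ξe‖) 0 := by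
    rcases hs0.eq_or_lt with h | h
    · rw [← h]
      exact ((hβK t ht.1).2.2.trans (hβK 0 le_rfl).2.2.symm).le
    · exact (hβL _ h).1 (mem_Ici.2 le_rfl) ht.1 ht.1
  have h2 := hψ₁.mono (hβ0 _ _ hs0 ht.1) hβt
  have hr : (eLpNorm u ⊤ (volume.restrict (Icc 0 t))).toReal
      ≤ (eLpNorm u ⊤ (volume.restrict (Icc 0 T))).toReal :=
    ENNReal.toReal_mono (hu T).2.ne
      (eLpNorm_mono_measure _ (Measure.restrict_mono (Icc_subset_Icc_right ht.2) le_rfl))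
  have h3 := (hψ₁.comp hσ).mono ENNReal.toReal_nonneg hr
  have h4 : 0 ≤ ψ₁ (β (ψ₂ ‖ξ₀ - ξe‖) 0) := hψ₁.nonneg (hβ0 _ _ hs0 le_rfl)
  have h5 := (hψ₁.comp hσ).nonneg
    (ENNReal.toReal_nonneg (a := eLpNorm u ⊤ (volume.restrict (Icc 0 T))))
  have h6 := norm_le_norm_add_norm_sub' (ξ t) ξe
  have h7 := max_le (h2.trans (le_add_of_nonneg_right h5)) (h3.trans (le_add_of_nonneg_left h4))
  linarith [h1.trans h7]

/-! ### The singularly perturbed system -/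

theorem isCaratheodoryField_perturbedSystem {n m p q : ℕ}
    {gs : Vec n → Vec m → Vec p → Vec n} {gf : Vec m → Vec n → Vec q → Vec m} {L : ℝ}
    (hgs : ∀ x x' z z' d d', ‖gs x z d - gs x' z' d'‖ ≤ L * (‖x - x'‖ + ‖z - z'‖ + ‖d - d'‖))
    (hL : 0 ≤ L) (hgf : IsRegularField gf) (cs cf : ℝ) :
    IsCaratheodoryField (perturbedSystem (fun _ _ _ => cs) (fun _ _ _ => cf) gs gf) := by
  have hnorm : ∀ (x : Vec n) (z : Vec m), ‖WithLp.toLp 2 (x, z)‖ ≤ ‖x‖ + ‖z‖ := by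
    intro x z
    rw [WithLp.prod_norm_eq_of_L2]
    refine Real.sqrt_le_iff.2 ⟨by positivity, ?_⟩
    have := mul_nonneg (norm_nonneg x) (norm_nonneg z)
    rw [WithLp.toLp_fst, WithLp.toLp_snd]
    nlinarith
  have hgsd : ∀ x z, LipschitzWith (Real.toNNReal L) (gs x z) := fun x z =>
    LipschitzWith.of_dist_le_mul fun d d' => by
      rw [Real.coe_toNNReal _ hL, dist_eq_norm, dist_eq_norm]
      simpa using hgs x x z z d d'
  refine ⟨fun R => ?_, fun ξ => ?_, fun R => ?_⟩
  · obtain ⟨K, hK⟩ := hgf.lipschitz R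
    refine ⟨|cs| * (2 * L) + |cf| * (2 * |K|), fun ξ η v hξ hη hv => ?_⟩
    have e : perturbedSystem (fun _ _ _ => cs) (fun _ _ _ => cf) gs gf ξ v -
        perturbedSystem (fun _ _ _ => cs) (fun _ _ _ => cf) gs gf η v =
        WithLp.toLp 2 (cs • (gs ξ.fst ξ.snd v.fst - gs η.fst η.snd v.fst),
          cf • (gf ξ.snd ξ.fst v.snd - gf η.snd η.fst v.snd)) := by
      simp only [perturbedSystem, smul_sub]
      rfl
    rw [e]
    refine (hnorm _ _).trans ?_
    rw [norm_smul, norm_smul, Real.norm_eq_abs, Real.norm_eq_abs, add_mul]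
    have h1 : ‖ξ.fst - η.fst‖ ≤ ‖ξ - η‖ := WithLp.norm_fst_le _ (ξ - η)
    have h2 : ‖ξ.snd - η.snd‖ ≤ ‖ξ - η‖ := WithLp.norm_snd_le _ (ξ - η)
    refine add_le_add ?_ ?_
    · rw [mul_assoc]
      refine mul_le_mul_of_nonneg_left ((hgs _ _ _ _ _ _).trans ?_) (abs_nonneg _)
      rw [sub_self, norm_zero, add_zero, mul_comm 2 L, mul_assoc]
      exact mul_le_mul_of_nonneg_left (by linarith) hL
    · rw [mul_assoc]
      refine mul_le_mul_of_nonneg_left ((hK _ _ _ _ _ ((WithLp.norm_snd_le _ ξ).trans hξ)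
        ((WithLp.norm_snd_le _ η).trans hη) ((WithLp.norm_fst_le _ ξ).trans hξ)
        ((WithLp.norm_fst_le _ η).trans hη) ((WithLp.norm_snd_le _ v).trans hv)).trans ?_)
        (abs_nonneg _)
      rw [mul_comm 2 |K|, mul_assoc]
      exact mul_le_mul (le_abs_self _) (by linarith) (by positivity) (abs_nonneg _)
  · have h1 : Measurable fun v : WithLp 2 (Vec p × Vec q) => cs • gs ξ.fst ξ.snd v.fst :=
      (((hgsd ξ.fst ξ.snd).continuous.comp (WithLp.continuous_fst 2 _ _)).const_smul cs).measurable
    have h2 : Measurable fun v : WithLp 2 (Vec p × Vec q) => cf • gf ξ.snd ξ.fst v.snd :=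
      ((hgf.measurable ξ.snd ξ.fst).comp
        (WithLp.continuous_snd 2 (Vec p) (Vec q)).measurable).const_smul cf
    exact (WithLp.prod_continuous_toLp 2 (Vec n) (Vec m)).measurable.comp (h1.prodMk h2)
  · obtain ⟨M, hM⟩ := hgf.bounded R
    refine ⟨|cs| * (‖gs 0 0 0‖ + L * (3 * R)) + |cf| * M, fun ξ v hξ hv => ?_⟩
    refine (hnorm _ _).trans ?_
    rw [norm_smul, norm_smul, Real.norm_eq_abs, Real.norm_eq_abs]
    have h1 := (WithLp.norm_fst_le _ ξ).trans hξ
    have h2 := (WithLp.norm_snd_le _ ξ).trans hξ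
    have h3 := (WithLp.norm_fst_le _ v).trans hv
    refine add_le_add (mul_le_mul_of_nonneg_left ?_ (abs_nonneg _))
      (mul_le_mul_of_nonneg_left (hM _ _ _ h2 h1 ((WithLp.norm_snd_le _ v).trans hv))
        (abs_nonneg _))
    have h4 := norm_le_norm_add_norm_sub' (gs ξ.fst ξ.snd v.fst) (gs 0 0 0)
    have h5 := hgs ξ.fst 0 ξ.snd 0 v.fst 0
    rw [sub_zero, sub_zero, sub_zero] at h5
    have h6 := mul_le_mul_of_nonneg_left
      (show ‖ξ.fst‖ + ‖ξ.snd‖ + ‖v.fst‖ ≤ 3 * R by linarith) hL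
    linarith

/-- The derivative of a function of two linear expressions, split into partial derivatives. -/
theorem fderiv_comp_apply_two {E X Y : Type*} [NormedAddCommGroup E] [NormedSpace ℝ E]
    [NormedAddCommGroup X] [NormedSpace ℝ X] [NormedAddCommGroup Y] [NormedSpace ℝ Y]
    {V : Y → X → ℝ} (hV : ContDiff ℝ 1 fun r : Y × X => V r.1 r.2) (A : E →L[ℝ] X)
    (B : E →L[ℝ] Y) (ξ w : E) :
    fderiv ℝ (fun ξ => V (B ξ) (A ξ)) ξ w =
      fderiv ℝ (fun z => V z (A ξ)) (B ξ) (B w) + fderiv ℝ (V (B ξ)) (A ξ) (A w) := by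
  have hd := (hV.differentiable (by simp) (B ξ, A ξ)).hasFDerivAt
  set D := fderiv ℝ (fun r : Y × X => V r.1 r.2) (B ξ, A ξ)
  have h1 : HasFDerivAt (fun ξ => V (B ξ) (A ξ)) (D.comp (B.prod A)) ξ :=
    HasFDerivAt.comp (g := fun r : Y × X => V r.1 r.2) ξ hd (B.prod A).hasFDerivAt
  have h2 : HasFDerivAt (fun z => V z (A ξ))
      (D.comp ((ContinuousLinearMap.id ℝ Y).prod 0)) (B ξ) :=
    HasFDerivAt.comp (g := fun r : Y × X => V r.1 r.2) (f := fun z => (z, A ξ)) (B ξ) hd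
      ((hasFDerivAt_id (B ξ)).prodMk (hasFDerivAt_const (A ξ) (B ξ)))
  have h3 : HasFDerivAt (V (B ξ))
      (D.comp ((0 : X →L[ℝ] Y).prod (ContinuousLinearMap.id ℝ X))) (A ξ) :=
    HasFDerivAt.comp (g := fun r : Y × X => V r.1 r.2) (f := fun x => (B ξ, x)) (A ξ) hd
      ((hasFDerivAt_const (B ξ) (A ξ)).prodMk (hasFDerivAt_id (A ξ)))
  rw [h1.fderiv, h2.fderiv, h3.fderiv]
  simp [← map_add]

theorem fderiv_comp_apply {E X : Type*} [NormedAddCommGroup E] [NormedSpace ℝ E]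
    [NormedAddCommGroup X] [NormedSpace ℝ X] {V : X → ℝ} (hV : ContDiff ℝ 1 V) (A : E →L[ℝ] X)
    (ξ w : E) : fderiv ℝ (fun ξ => V (A ξ)) ξ w = fderiv ℝ V (A ξ) (A w) := by
  have h : HasFDerivAt (fun ξ => V (A ξ)) ((fderiv ℝ V (A ξ)).comp A) ξ :=
    ((hV.differentiable (by simp)) (A ξ)).hasFDerivAt.comp ξ A.hasFDerivAt
  rw [h.fderiv]
  rfl

/-- The Lipschitz estimate for the inverse is compared with its value at zero. Thus the fast decay
rate is at least linear, as is needed to dominate a cross term of order `V_f`. -/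
theorem HasGloballyLipschitzInverse.exists_linear_lower_bound {α : ℝ → ℝ} (hα : IsPD α)
    (h : HasGloballyLipschitzInverse α) : ∃ L, 0 < L ∧ ∀ r, 0 ≤ r → r ≤ L * α r := by
  obtain ⟨β, hα0, -, ⟨hinv, -⟩, L, hL⟩ := h
  refine ⟨L + 1, by positivity, fun r hr => ?_⟩
  have h0 : (0 : ℝ) ∈ Ici (0 : ℝ) := mem_Ici.2 le_rfl
  have hβ0 : β 0 = 0 := by simpa [hα.2.2] using hinv h0
  have h1 := hL.dist_le_mul (α r) (hα0 hr) 0 h0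
  have h2 : 0 ≤ α r := hα0 hr
  rw [hinv hr, hβ0, Real.dist_eq, Real.dist_eq, sub_zero, sub_zero, abs_of_nonneg hr,
    abs_of_nonneg h2] at h1
  linarith

theorem corollary1 {n m p q : ℕ}
    (gs : Vec n → Vec m → Vec p → Vec n) (gf : Vec m → Vec n → Vec q → Vec m)
    (φ : Vec n → Vec m) (Vs : Vec n → ℝ) (Vf : Vec m → Vec n → ℝ)
    (αsl αsu γs χs αs αfl αfu χf αf lf1 lf2 : ℝ → ℝ)
    (hreg : IsRegularField gf)
    (hsteady : SteadyState gs gf φ)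
    (hslow : SlowLyapunov gs Vs Vf αsl αsu γs χs αs)
    (hfast : FastLyapunov gf φ Vs Vf αfl αfu χf αf lf1 lf2)
    (hgs : ∃ L : NNReal, LipschitzWith L
      (fun v : Vec n × Vec m × Vec p => gs v.1 v.2.1 v.2.2))
    (hγs : IsGloballyLipschitz γs)
    (hαf : HasGloballyLipschitzInverse αf)
    (hαfl : IsSquareFun αfl) (hαsl : IsSquareFun αsl)
    (hlf1 : IsSqrtFun lf1) (hlf2 : IsSqrtFun lf2) :
    ∃ cs cf : ℝ, 0 < cs ∧ 0 < cf ∧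
      IsISS (perturbedSystem (fun _ _ _ => cs) (fun _ _ _ => cf) gs gf)
        (WithLp.toLp 2 (0, φ 0)) := by
  obtain ⟨L, hL⟩ := hgs
  obtain ⟨Lγ, hLγ⟩ := hγs
  obtain ⟨a, ha, hαsl⟩ := hαsl
  obtain ⟨b, hb, hαfl⟩ := hαfl
  obtain ⟨a₁, ha₁, hlf1⟩ := hlf1
  obtain ⟨a₂, ha₂, hlf2⟩ := hlf2
  obtain ⟨Lf, hLf0, hLf⟩ := hαf.exists_linear_lower_bound hfast.alpha_class
  have hVsl : ∀ x, a * ‖x‖ ^ 2 ≤ Vs x := fun x => hαsl _ (norm_nonneg x) ▸ hslow.lower x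
  have hVfl : ∀ z x, b * ‖z - φ x‖ ^ 2 ≤ Vf z x := fun z x =>
    hαfl _ (norm_nonneg (z - φ x)) ▸ hfast.lower z x
  have hVs0 : ∀ x, 0 ≤ Vs x := fun x => le_trans (by positivity) (hVsl x)
  have hVf0 : ∀ z x, 0 ≤ Vf z x := fun z x => le_trans (by positivity) (hVfl z x)
  have hVsz : Vs 0 = 0 := le_antisymm (by
    have := hslow.upper 0
    rwa [norm_zero, hslow.upper_class.1.2.2] at this) (hVs0 0)
  have hVfz : ∀ x, Vf (φ x) x = 0 := fun x => le_antisymm (by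
    have := hfast.upper (φ x) x
    rwa [sub_self, norm_zero, hfast.upper_class.1.2.2] at this) (hVf0 _ x)
  have hcross : ∀ z x, ‖fderiv ℝ (Vf z) x‖ ≤ a₁ * √(Vf z x) + a₂ * √(Vs x) := fun z x => by
    rw [← hlf1 _ (hVf0 z x), ← hlf2 _ (hVs0 x)]
    exact hfast.cross z x
  have hγ : ∀ r, 0 ≤ r → γs r ≤ Lγ * r := fun r hr => by
    have h1 := hLγ.dist_le_mul r hr 0 (mem_Ici.2 le_rfl)
    rw [hslow.gamma_class.1.2.2, Real.dist_eq, Real.dist_eq, sub_zero, sub_zero,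
      abs_of_nonneg hr] at h1
    exact (le_abs_self _).trans h1
  have hgsL : ∀ x x' z z' d d',
      ‖gs x z d - gs x' z' d'‖ ≤ L * (‖x - x'‖ + ‖z - z'‖ + ‖d - d'‖) := by
    intro x x' z z' d d'
    have h1 := hL.dist_le_mul (x, z, d) (x', z', d')
    simp only [dist_eq_norm] at h1
    refine h1.trans (mul_le_mul_of_nonneg_left ?_ L.2)
    have n1 := norm_nonneg (x - x')
    have n2 := norm_nonneg (z - z')
    have n3 := norm_nonneg (d - d')
    exact max_le (by simp only [Prod.fst_sub]; linarith)
      (max_le (by simp only [Prod.fst_sub, Prod.snd_sub]; linarith)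
        (by simp only [Prod.snd_sub]; linarith))
  have hVfC : ∀ z, ContDiff ℝ 1 (Vf z) := fun z =>
    hfast.contDiff.comp (contDiff_const.prodMk contDiff_id)
  obtain ⟨C, hC0, hC⟩ := exists_slow_field_bound (h := fun x z => gs x z 0)
    hsteady.locallyLipschitz L.2 (fun x x' z z' => by simpa using hgsL x x' z z' 0 0)
    hslow.contDiff hVfC ha hb ha₁.le ha₂.le hVsl hVfl hVfz hcross (fun x => by
      -- At `z = φ(x)` and `d = 0` both gain terms vanish, so the decrease condition holds
      -- unconditionally.
      refine (hslow.decrease x (φ x) 0 ?_).trans ?_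
      · rw [hVfz, norm_zero, hslow.gamma_class.1.2.2, hslow.chi_class.1.2.2, max_self]
        exact hVs0 x
      · rcases (hVs0 x).eq_or_lt with h | h
        · rw [← h, hslow.alpha_class.2.2, neg_zero]
        · exact (neg_neg_of_pos (hslow.alpha_class.2.1 _ h)).le)
  have hsb : 0 < √b := Real.sqrt_pos.2 hb
  set κ : ℝ := Lγ + 1 with hκ
  have hκ0 : 0 < κ := by positivity
  set A := a₁ + a₂ * √κ with hA
  set K := C * √κ + L / √b + L with hK
  have hA0 : 0 ≤ A := by positivity
  have hK0 : 0 ≤ K := by positivity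
  have hcf : 0 < Lf * (A * K + 1) := by positivity
  -- Where `V_s ≤ κ V_f`, the cross term is at most `A K V_f`. The factor `L_f` turns `α_f` into a
  -- linear rate, and the extra `1` leaves a net decay of `V_f`.
  refine ⟨1, Lf * (A * K + 1), one_pos, hcf, ?_⟩
  set cf := Lf * (A * K + 1)
  -- Needed to pass from `|z - φ(x)|`, which `V_f` controls, to `|z - φ(0)|`.
  obtain ⟨ω, hω, hφω⟩ := exists_isK_bound (W := fun x => ‖φ x - φ 0‖) (e := 0)
    (hsteady.locallyLipschitz.continuous.sub continuous_const).norm (by simp)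
  have hVC : ContDiff ℝ 1 fun ξ : WithLp 2 (Vec n × Vec m) => Vs ξ.fst :=
    hslow.contDiff.comp (WithLp.fstL 2 ℝ (Vec n) (Vec m)).contDiff
  have hWC' : ContDiff ℝ 1 fun ξ : WithLp 2 (Vec n × Vec m) => Vf ξ.snd ξ.fst :=
    hfast.contDiff.comp ((WithLp.sndL 2 ℝ (Vec n) (Vec m)).contDiff.prodMk
      (WithLp.fstL 2 ℝ (Vec n) (Vec m)).contDiff)
  have hWC : ContDiff ℝ 1 fun ξ : WithLp 2 (Vec n × Vec m) => κ * Vf ξ.snd ξ.fst :=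
    contDiff_const.mul hWC'
  obtain ⟨ψ, hψ, hψW⟩ := exists_isK_bound (hVC.continuous.max hWC.continuous)
    (e := WithLp.toLp 2 (0, φ 0)) (by simp [hVsz, hVfz])
  have hα : IsPD fun r => min (αs r) r :=
    ⟨ContinuousOn.inf hslow.alpha_class.1 continuousOn_id,
      fun r hr => lt_min (hslow.alpha_class.2.1 r hr) hr, by simp [hslow.alpha_class.2.2]⟩
  -- The last term is not one of the given gains: it yields `|d| ≤ √V_f` where `κ V_f` is the
  -- maximum, so that the effect of `d` on `g_s` is also `O(√V_f)`.
  have hσ : IsK fun r => χs r + κ * χf r + κ * r ^ 2 :=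
    (hslow.chi_class.1.add (hfast.chi_class.1.const_mul hκ0)).add (isK_sq.const_mul hκ0)
  have hσle : ∀ r, 0 ≤ r → χs r ≤ χs r + κ * χf r + κ * r ^ 2 ∧
      κ * χf r ≤ χs r + κ * χf r + κ * r ^ 2 ∧ κ * r ^ 2 ≤ χs r + κ * χf r + κ * r ^ 2 := by
    intro r hr
    have h1 := hslow.chi_class.1.nonneg hr
    have h2 := mul_nonneg hκ0.le (hfast.chi_class.1.nonneg hr)
    have h3 := mul_nonneg hκ0.le (sq_nonneg r)
    exact ⟨by linarith, by linarith, by linarith⟩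
  refine isISS_of_lyapunov_max (isCaratheodoryField_perturbedSystem hgsL L.2 hreg 1 cf) hVC hWC
    (fun ξ => hVs0 _) hα hσ
    (((isK_sqrt_div ha).add (isK_sqrt_div (mul_pos hκ0 hb))).add (hω.comp (isK_sqrt_div ha)))
    hψ ?_ hψW ?_ ?_
  · intro ξ
    set M := max (Vs ξ.fst) (κ * Vf ξ.snd ξ.fst) with hM
    have h1 : ‖ξ.fst‖ ≤ √(M / a) := by
      refine Real.le_sqrt_of_sq_le ?_
      rw [le_div_iff₀ ha, mul_comm]
      exact (hVsl _).trans (le_max_left _ _)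
    have h2 : ‖ξ.snd - φ ξ.fst‖ ≤ √(M / (κ * b)) := by
      refine Real.le_sqrt_of_sq_le ?_
      rw [le_div_iff₀ (mul_pos hκ0 hb), mul_comm, mul_assoc]
      exact (mul_le_mul_of_nonneg_left (hVfl _ _) hκ0.le).trans (le_max_right _ _)
    have h3 : ‖φ ξ.fst - φ 0‖ ≤ ω √(M / a) := by
      refine (hφω ξ.fst).trans (hω.mono (norm_nonneg _) ?_)
      rwa [sub_zero]
    have h4 : ‖ξ - WithLp.toLp 2 (0, φ 0)‖ ≤ ‖ξ.fst‖ + ‖ξ.snd - φ 0‖ := by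
      rw [WithLp.prod_norm_eq_of_L2]
      refine Real.sqrt_le_iff.2 ⟨by positivity, ?_⟩
      simp only [WithLp.sub_fst, WithLp.sub_snd, WithLp.toLp_fst, WithLp.toLp_snd, sub_zero]
      have := mul_nonneg (norm_nonneg ξ.fst) (norm_nonneg (ξ.snd - φ 0))
      nlinarith
    have h5 := norm_sub_le_norm_sub_add_norm_sub ξ.snd (φ ξ.fst) (φ 0)
    linarith
  · intro ξ v hv hle
    have hσ1 := (hσle ‖v‖ (norm_nonneg v)).1
    have hd : χs ‖v.fst‖ ≤ Vs ξ.fst :=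
      (hslow.chi_class.1.mono (norm_nonneg _) (WithLp.norm_fst_le _ v)).trans (hσ1.trans hv)
    have hg : γs (Vf ξ.snd ξ.fst) ≤ Vs ξ.fst := by
      refine (hγ _ (hVf0 _ _)).trans (le_trans ?_ hle)
      exact mul_le_mul_of_nonneg_right (by rw [hκ]; linarith) (hVf0 _ _)
    have h1 := hslow.decrease ξ.fst ξ.snd v.fst (max_le hg hd)
    have h2 := fderiv_comp_apply hslow.contDiff (WithLp.fstL 2 ℝ (Vec n) (Vec m)) ξ
      (perturbedSystem (fun _ _ _ => 1) (fun _ _ _ => cf) gs gf ξ v)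
    simp only [WithLp.fstL_apply, perturbedSystem, WithLp.toLp_fst, one_smul] at h2
    simp only [perturbedSystem, one_smul]
    rw [h2]
    exact h1.trans (neg_le_neg (min_le_left _ _))
  · intro ξ v hv hle
    obtain ⟨-, hσ2, hσ3⟩ := hσle ‖v‖ (norm_nonneg v)
    set F := Vf ξ.snd ξ.fst with hF
    have hF0 : 0 ≤ F := hVf0 _ _
    have hw : χf ‖v.snd‖ ≤ F := le_of_mul_le_mul_left
      ((mul_le_mul_of_nonneg_left (hfast.chi_class.1.mono (norm_nonneg _) (WithLp.norm_snd_le _ v))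
        hκ0.le).trans (hσ2.trans hv)) hκ0
    have hd : ‖v.fst‖ ≤ √F := by
      refine (WithLp.norm_fst_le _ v).trans (Real.le_sqrt_of_sq_le ?_)
      exact le_of_mul_le_mul_left (hσ3.trans hv) hκ0
    have hVs : √(Vs ξ.fst) ≤ √κ * √F := by
      rw [← Real.sqrt_mul hκ0.le]
      exact Real.sqrt_le_sqrt hle
    have hz : ‖ξ.snd - φ ξ.fst‖ ≤ √F / √b := by
      rw [le_div_iff₀ hsb, mul_comm]
      refine Real.le_sqrt_of_sq_le ?_
      rw [mul_pow, Real.sq_sqrt hb.le]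
      exact hVfl _ _
    have hgsb : ‖gs ξ.fst ξ.snd v.fst‖ ≤ K * √F := by
      have h1 := norm_le_norm_add_norm_sub' (gs ξ.fst ξ.snd v.fst) (gs ξ.fst (φ ξ.fst) 0)
      have h2 := hgsL ξ.fst ξ.fst ξ.snd (φ ξ.fst) v.fst 0
      rw [sub_self, norm_zero, zero_add, sub_zero] at h2
      have h3 := mul_le_mul_of_nonneg_left (add_le_add hz hd) L.2
      have h4 := (hC ξ.fst).trans (mul_le_mul_of_nonneg_left hVs hC0)
      have h5 : K * √F = C * (√κ * √F) + L * (√F / √b + √F) := by rw [hK]; ring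
      rw [h5]
      exact h1.trans (add_le_add h4 (h2.trans h3))
    have hgrad : ‖fderiv ℝ (Vf ξ.snd) ξ.fst‖ ≤ A * √F := by
      refine (hcross _ _).trans ?_
      have h1 := mul_le_mul_of_nonneg_left hVs ha₂.le
      have h2 : A * √F = a₁ * √F + a₂ * (√κ * √F) := by rw [hA]; ring
      rw [h2]
      exact add_le_add le_rfl h1
    have hx : fderiv ℝ (Vf ξ.snd) ξ.fst (gs ξ.fst ξ.snd v.fst) ≤ A * K * F := by
      refine (Real.le_norm_self _).trans ((ContinuousLinearMap.le_opNorm _ _).trans ?_)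
      refine (mul_le_mul hgrad hgsb (norm_nonneg _) (by positivity)).trans (le_of_eq ?_)
      rw [mul_mul_mul_comm, Real.mul_self_sqrt hF0]
    have hzd := hfast.decrease ξ.snd ξ.fst v.snd hw
    have hzd' : cf * fderiv ℝ (fun z' => Vf z' ξ.fst) ξ.snd (gf ξ.snd ξ.fst v.snd)
        ≤ -((A * K + 1) * F) := by
      refine (mul_le_mul_of_nonneg_left hzd hcf.le).trans ?_
      have h1 := mul_le_mul_of_nonneg_left (hLf F hF0) (show 0 ≤ A * K + 1 by positivity)
      have h2 : cf * -αf F = -((A * K + 1) * (Lf * αf F)) := by ring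
      rw [h2]
      exact neg_le_neg h1
    have hfd : fderiv ℝ (fun ξ : WithLp 2 (Vec n × Vec m) => κ * Vf ξ.snd ξ.fst) ξ
        (perturbedSystem (fun _ _ _ => 1) (fun _ _ _ => cf) gs gf ξ v)
        = κ * (cf * fderiv ℝ (fun z' => Vf z' ξ.fst) ξ.snd (gf ξ.snd ξ.fst v.snd)
          + fderiv ℝ (Vf ξ.snd) ξ.fst (gs ξ.fst ξ.snd v.fst)) := by
      rw [fderiv_const_mul (hWC'.differentiable (by simp) ξ), smul_apply, smul_eq_mul]
      have h2 := fderiv_comp_apply_two hfast.contDiff (WithLp.fstL 2 ℝ (Vec n) (Vec m))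
        (WithLp.sndL 2 ℝ (Vec n) (Vec m)) ξ
        (perturbedSystem (fun _ _ _ => 1) (fun _ _ _ => cf) gs gf ξ v)
      simp only [WithLp.fstL_apply, WithLp.sndL_apply, perturbedSystem, WithLp.toLp_fst,
        WithLp.toLp_snd, one_smul, map_smul, smul_eq_mul] at h2
      simp only [perturbedSystem, one_smul]
      rw [h2]
    rw [hfd]
    refine le_trans ?_ (neg_le_neg (min_le_right _ _))
    have h1 : κ * (cf * fderiv ℝ (fun z' => Vf z' ξ.fst) ξ.snd (gf ξ.snd ξ.fst v.snd)
          + fderiv ℝ (Vf ξ.snd) ξ.fst (gs ξ.fst ξ.snd v.fst)) ≤ κ * (-F) :=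
      mul_le_mul_of_nonneg_left (by linarith) hκ0.le
    rw [mul_neg] at h1
    exact h1
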